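/- For integers $m,\ell\ge 0$ let $w_{m,2\ell}$ be the number of closed walks with $2\ell$ steps on the complete graph with vertex set $\{1,\dots,m\}$ that visit every vertex and whose set of traversed edges forms a tree (so $w_{1,0}=1$, $w_{1,2\ell}=0$ for $\ell\ge 1$, and $w_{0,2\ell}=0$ for all $\ell\ge 0$). Such a walk is called a tree walk; its excess is its half-length minus the number of edges of its tree, $\ell-(m-1)$. For $\xi\ge 0$ let $$W_\xi(z)=\sum_{\ell\ge \xi}\frac{w_{\ell-\xi+1,\,2\ell}}{(\ell-\xi+1)!}\,z^\ell$$ be the generating function of tree walks of excess $\xi$, and let $C(z)=\frac{1-\sqrt{1-4z}}{2z}=\sum_{n\ge 0}\operatorname{Cat}(n)z^n$ be the generating function of the Catalan numbers. Then $W_0(z)=C(z)$. Moreover, for every $\xi\ge 1$ there are polynomials $K_{\xi,s}(x)$, $0\le s\le 2\xi-2$, with non-negative rational coefficients, where $K_{\xi,s}$ has degree exactly $2\xi+s$, such that, as formal power series, $$W_\xi(z)=C(z)\sum_{s=0}^{2\xi-2}\frac{K_{\xi,s}\big(zC(z)^2\big)}{\big(1-zC(z)^2\big)^{s+1}},$$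 and such that $K_{\xi,2\xi-2}(x)=\operatorname{Cat}(\xi-1)\,x^{4\xi-2}$ and, if $\xi\ge 2$, $K_{\xi,2\xi-3}(x)=(3\xi-1)\operatorname{Cat}(\xi-1)\,x^{4\xi-3}$. -/

import Mathlib

open Polynomial

/-- A tree walk of size `m` and length `L`: a closed walk with `L` steps on the complete graph on
the vertex set `Fin m`, which visits every vertex and such that the graph formed by the edges it
traverses is a tree. -/
structure TreeWalk (m L : ℕ) where
  /-- the vertex at which the walk starts and ends -/
  root : Fin m
  /-- the closed walk -/
  walk : (⊤ : SimpleGraph (Fin m)).Walk root root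
  length_eq : walk.length = L
  visits : ∀ x : Fin m, x ∈ walk.support
  isTree : (SimpleGraph.fromEdgeSet {e | e ∈ walk.edges}).IsTree

instance TreeWalk.instFinite (m L : ℕ) : Finite (TreeWalk m L) := by
  classical
  let f : TreeWalk m L →
      (Σ r : Fin m, {p : (⊤ : SimpleGraph (Fin m)).Walk r r // p.length = L}) :=
    fun W => ⟨W.root, ⟨W.walk, W.length_eq⟩⟩
  refine Finite.of_injective f ?_
  rintro ⟨r, p, hp, _, _⟩ ⟨r', p', hp', _, _⟩ h
  simp only [f, Sigma.mk.injEq] at h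
  obtain ⟨rfl, h⟩ := h
  have h2 := congrArg Subtype.val (eq_of_heq h)
  simp only at h2
  subst h2
  rfl

/-- The number of tree walks of length `L` that span a tree of size `m`. -/
noncomputable def numTreeWalks (m L : ℕ) : ℕ := Nat.card (TreeWalk m L)

/-- The generating function of the tree walks of excess `ξ`, where the excess is the half-length
minus the number of edges of the induced tree. A walk of length `2 * l` has excess `ξ` exactly when
its tree has `l - ξ` edges, that is, `l - ξ + 1` vertices. The variable marks the half-length, and
the labelled walks are counted with weight one over the factorial of the number of vertices. -/
noncomputable def excessGF (ξ : ℕ) : PowerSeries ℚ :=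
  PowerSeries.mk fun l =>
    if ξ ≤ l then
      (numTreeWalks (l - ξ + 1) (2 * l) : ℚ) / (Nat.factorial (l - ξ + 1) : ℚ)
    else 0

/-- The generating function of the Catalan numbers, with rational coefficients. -/
noncomputable def catalanGF : PowerSeries ℚ :=
  PowerSeries.map (Nat.castRingHom ℚ) PowerSeries.catalanSeries

/-! Consider `j`-tuples of closed walks at a common root whose edges together form a tree; the
theorem is the case `j = 1`. If the last walk is empty, drop it. Otherwise its first step crosses an
edge `rv`, which is a bridge. If the tuple crosses it `i + 1` times each way, cutting there gives `i
+ k + 1` closed walks at `r` and `i + 1` closed walks at `v` (with `j = k + 1`), and the other `i`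
excursions are distributed over the `k + 1` walks in `(i + k).choose k` ways. The two sides span
disjoint trees, and the excess is `i` plus the two excesses. This recursion determines all the
series, so it suffices to solve it and to show that walks obey it.

Solution. Write `x` for `hx` and `y` for the outer variable, to be evaluated at `x = zC²` and `y = 1
/ (1 - x)`. Edges crossed once each way with nothing of positive excess behind them are absorbed by
`C = 1 + x`; those with the whole excess behind them form chains, summed by `y = 1 + x y`. What
remains is a recursion in ℕ[x][y] for `kernel n k` and `branch n j`, and `C ^ j` times the
evaluation of `branch n j` satisfies the walk recursion (`tupleGF_succ`). Since `branch n 1`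
evaluates to `y * kernel n 0` for `n ≠ 0`, the numerators are the `y`-coefficients of `kernel n 0`.
Their degrees follow from `isBdd_kernel` and `kernel_isPos`; in top `y`-degree only edges crossed
once each way contribute, which leaves the Catalan convolution.

Walks. For a fixed tree, inclusion and exclusion over its edge subsets isolates the tuples that use
every edge. Across a bridge the resolvent satisfies `G = A + z² A B G`, and expanding `G ^ (k + 1)`
gives the binomial recursion (`coverStepGF_insert_union`). Summing over trees, split at `rv` into
two trees, gives `totalGF_succ`. The label counts collapse to a factorial, so `totalGF_eq` matches
both sides by induction. -/

namespace TreeWalkKernel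

open Finset.HasAntidiagonal (antidiagonal mem_antidiagonal)

/-! ### Kernel polynomials and their recursion. -/

/-- The polynomial variable marking the half-length of a core walk. -/
noncomputable abbrev hx : ℕ[X][X] := Polynomial.C Polynomial.X

/-- The generating polynomial of the tuples of `j` core walks of total excess `n`, in terms of the
generating polynomials `F` of the kernels. -/
noncomputable def branchOf (F : ℕ → ℕ → ℕ[X][X]) (n j : ℕ) : ℕ[X][X] :=
  if n = 0 then 1 else ∑ k ∈ Finset.range j, (hx * X * F n 0 + F n k)

/-- The contribution of an edge at the root traversed `i + 1` times in each direction, together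
with everything that hangs on it. -/
noncomputable def blockOf (F : ℕ → ℕ → ℕ[X][X]) (n i : ℕ) : ℕ[X][X] :=
  if i = 0 then hx * X * F n 0 else
    if i ≤ n then hx ^ (i + 1) * branchOf F (n - i) (i + 1) else 0

/-- The sum over the ways to split off the first edge of a tuple of walks. -/
noncomputable def splitOf (F : ℕ → ℕ → ℕ[X][X]) (n k : ℕ) : ℕ[X][X] :=
  ∑ i ∈ Finset.range (n + 1), ∑ p ∈ antidiagonal n,
    ((i + k).choose k : ℕ[X][X]) * (branchOf F p.1 (i + k + 1) * blockOf F p.2 i)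

/-- The generating polynomial of the kernels of excess `n`; the outer variable marks the
edges traversed exactly twice. -/
noncomputable def kernel (n k : ℕ) : ℕ[X][X] :=
  splitOf (fun m j => if m < n then kernel m j else 0) n k
termination_by n

/-- The generating polynomial of the tuples of `j` core walks of total excess `n`. -/
noncomputable def branch (n j : ℕ) : ℕ[X][X] := branchOf kernel n j

/-- `blockOf` for the kernel polynomials. -/
noncomputable def block (n i : ℕ) : ℕ[X][X] := blockOf kernel n i

lemma branchOf_zero (F : ℕ → ℕ → ℕ[X][X]) (j : ℕ) : branchOf F 0 j = 1 := by simp [branchOf]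

lemma branchOf_congr {F G : ℕ → ℕ → ℕ[X][X]} {n : ℕ} (h : F n = G n) (j : ℕ) :
    branchOf F n j = branchOf G n j := by
  simp [branchOf, h]

@[simp] lemma branch_zero (j : ℕ) : branch 0 j = 1 := branchOf_zero _ _

lemma block_zero (n : ℕ) : block n 0 = hx * X * kernel n 0 := by
  rw [block, blockOf, if_pos rfl]

lemma block_succ (n i : ℕ) :
    block n (i + 1) = if i + 1 ≤ n then hx ^ (i + 2) * branch (n - (i + 1)) (i + 2) else 0 := by
  rw [block, blockOf, if_neg (Nat.succ_ne_zero i)]; rfl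

lemma branch_of_ne_zero {n : ℕ} (hn : n ≠ 0) (j : ℕ) :
    branch n j = ∑ k ∈ Finset.range j, (hx * X * kernel n 0 + kernel n k) := by
  simp [branch, branchOf, hn]

lemma kernel_zero (k : ℕ) : kernel 0 k = 0 := by
  rw [kernel]
  simp [splitOf, blockOf]

lemma sum_antidiagonal_ite_le {M : Type*} [AddCommMonoid M] (f : ℕ → ℕ → M) {n i : ℕ}
    (h : i ≤ n) :
    (∑ p ∈ antidiagonal n, if i ≤ p.2 then f p.1 (p.2 - i) else 0) =
      ∑ p ∈ antidiagonal (n - i), f p.1 p.2 := by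
  rw [← Finset.sum_filter]
  refine Finset.sum_bij' (fun p _ => (p.1, p.2 - i)) (fun p _ => (p.1, p.2 + i)) ?_ ?_ ?_ ?_ ?_
  · rintro ⟨a, b⟩ hp
    simp only [Finset.mem_filter, mem_antidiagonal] at hp ⊢
    omega
  · rintro ⟨a, b⟩ hp
    simp only [Finset.mem_filter, mem_antidiagonal] at hp ⊢
    omega
  · rintro ⟨a, b⟩ hp
    simp only [Finset.mem_filter, mem_antidiagonal] at hp ⊢
    ext <;> simp; omega
  · rintro ⟨a, b⟩ hp
    simp
  · intros; rfl

lemma branchOf_truncate {m n : ℕ} (h : m < n) (j : ℕ) :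
    branchOf (fun m j => if m < n then kernel m j else 0) m j = branch m j :=
  branchOf_congr (by ext1 i; exact if_pos h) j

/-- The truncation in the definition of `kernel` deletes just one term that could be nonzero: `i =
0` with the whole excess `n` behind the first edge, where the recursion would refer to itself. Hence
the exclusion of `p.1 = 0`; at `p.2 = 0` the factor `kernel 0 0` vanishes anyway. -/
lemma kernel_eq_sum (n k : ℕ) :
    kernel n k = (∑ p ∈ antidiagonal n,
        if p.1 = 0 then 0 else branch p.1 (k + 1) * (hx * X * kernel p.2 0)) +
      ∑ i ∈ Finset.range n, ∑ p ∈ antidiagonal (n - (i + 1)),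
        ((i + 1 + k).choose k : ℕ[X][X]) *
          (branch p.1 (i + 1 + k + 1) * (hx ^ (i + 2) * branch p.2 (i + 2))) := by
  rw [kernel, splitOf, Finset.sum_range_succ', add_comm]
  refine congrArg₂ (· + ·) ?_ ?_
  · refine Finset.sum_congr rfl fun p hp => ?_
    rw [mem_antidiagonal] at hp
    simp only [zero_add, Nat.choose_self, Nat.cast_one, one_mul, blockOf, if_true]
    by_cases h2 : p.2 < n
    · have h1 : p.1 ≠ 0 := by omega
      rw [if_pos h2, if_neg h1]
      by_cases h0 : p.2 = 0
      · rw [h0, kernel_zero, mul_zero, mul_zero, mul_zero]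
      · rw [branchOf_truncate (by omega)]
    · have h1 : p.1 = 0 := by omega
      rw [if_neg h2, if_pos h1, mul_zero, mul_zero]
  · refine Finset.sum_congr rfl fun i hi => ?_
    rw [Finset.mem_range] at hi
    refine Eq.trans (Finset.sum_congr rfl fun p hp => ?_)
      (sum_antidiagonal_ite_le (fun a b => ((i + 1 + k).choose k : ℕ[X][X]) *
          (branch a (i + 1 + k + 1) * (hx ^ (i + 2) * branch b (i + 2))))
          (show i + 1 ≤ n by omega))
    rw [mem_antidiagonal] at hp
    by_cases h : i + 1 ≤ p.2
    · rw [if_pos h, blockOf, if_neg (by omega), if_pos h,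
        branchOf_truncate (by omega), branchOf_truncate (by omega)]
    · rw [if_neg h, blockOf, if_neg (by omega), if_neg h, mul_zero, mul_zero]

lemma kernel_one (k : ℕ) : kernel 1 k = ((1 + k).choose k : ℕ[X][X]) * hx ^ 2 := by
  rw [kernel_eq_sum]
  simp [Finset.Nat.antidiagonal_succ, kernel_zero]

lemma kernel_add_two (m k : ℕ) :
    kernel (m + 2) k = (∑ p ∈ antidiagonal m,
        branch (p.1 + 1) (k + 1) * (hx * X * kernel (p.2 + 1) 0)) +
      ∑ i ∈ Finset.range (m + 2), ∑ p ∈ antidiagonal (m + 1 - i),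
        ((i + 1 + k).choose k : ℕ[X][X]) *
          (branch p.1 (i + 1 + k + 1) * (hx ^ (i + 2) * branch p.2 (i + 2))) := by
  rw [kernel_eq_sum]
  refine congrArg₂ (· + ·) ?_ ?_
  · rw [Finset.Nat.sum_antidiagonal_succ, Finset.Nat.sum_antidiagonal_succ']
    simp [kernel_zero]
  · refine Finset.sum_congr rfl fun i hi => ?_
    rw [show m + 2 - (i + 1) = m + 1 - i by omega]

/-- The self-referential term deleted from `kernel n k` is exactly the summand `hx * X * kernel n 0`
of `branch`, so the first-edge recursion holds without truncation. -/
lemma branch_succ (n k : ℕ) :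
    branch n (k + 1) = branch n k + ∑ i ∈ Finset.range (n + 1), ∑ p ∈ antidiagonal n,
      ((i + k).choose k : ℕ[X][X]) * (branch p.1 (i + k + 1) * block p.2 i) := by
  rcases eq_or_ne n 0 with rfl | hn
  · simp [block, blockOf, kernel_zero]
  have h0 : branch n (k + 1) = branch n k + (hx * X * kernel n 0 + kernel n k) := by
    rw [branch_of_ne_zero hn, branch_of_ne_zero hn, Finset.sum_range_succ]
  rw [h0]
  refine congrArg (branch n k + ·) ?_
  rw [kernel_eq_sum n k, Finset.sum_range_succ', ← add_assoc,
    add_comm (∑ i ∈ Finset.range n, _) (∑ p ∈ antidiagonal n, _)]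
  refine congrArg₂ (· + ·) ?_ ?_
  · have h : hx * X * kernel n 0 = ∑ p ∈ antidiagonal n,
        if p.1 = 0 then branch p.1 (k + 1) * (hx * X * kernel p.2 0) else 0 := by
      rw [Finset.sum_eq_single (0, n)]
      · rw [if_pos rfl, branch_zero, one_mul]
      · rintro ⟨a, b⟩ hp hne
        rw [mem_antidiagonal] at hp
        rw [if_neg]
        rintro rfl
        exact hne (by rw [← hp, zero_add])
      · intro h
        exact absurd (mem_antidiagonal.2 (zero_add n)) h
    rw [h, ← Finset.sum_add_distrib]
    refine Finset.sum_congr rfl fun p _ => ?_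
    rw [zero_add, Nat.choose_self, Nat.cast_one, one_mul, block_zero]
    split_ifs
    · rw [add_zero]
    · rw [zero_add]
  · refine Finset.sum_congr rfl fun i hi => ?_
    rw [Finset.mem_range] at hi
    refine Eq.trans (sum_antidiagonal_ite_le (fun a b => ((i + 1 + k).choose k : ℕ[X][X]) *
          (branch a (i + 1 + k + 1) * (hx ^ (i + 2) * branch b (i + 2))))
          (show i + 1 ≤ n by omega)).symm (Finset.sum_congr rfl fun p hp => ?_)
    rw [block_succ]
    split_ifs
    · rfl
    · rw [mul_zero, mul_zero]

/-! ### Degree bounds and divisibility by powers of `hx`. -/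

/-- The degree of `f` is at most `e`, and its `s`-th coefficient has degree at most `c + s`. -/
def IsBdd (c e : ℕ) (f : ℕ[X][X]) : Prop :=
  f.natDegree ≤ e ∧ ∀ s, (f.coeff s).natDegree ≤ c + s

namespace IsBdd

lemma zero (c e : ℕ) : IsBdd c e 0 := by simp [IsBdd]

lemma mono {c e c' e' : ℕ} {f : ℕ[X][X]} (h : IsBdd c e f) (hc : c ≤ c') (he : e ≤ e') :
    IsBdd c' e' f :=
  ⟨h.1.trans he, fun s => (h.2 s).trans (by omega)⟩

lemma C_mk {c : ℕ} {a : ℕ[X]} (h : a.natDegree ≤ c) (e : ℕ) :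
    IsBdd c e (Polynomial.C a) := by
  refine ⟨by simp, fun s => ?_⟩
  rw [coeff_C]
  split_ifs
  · omega
  · simp

lemma add {c e : ℕ} {f g : ℕ[X][X]} (hf : IsBdd c e f) (hg : IsBdd c e g) :
    IsBdd c e (f + g) :=
  ⟨natDegree_add_le_of_degree_le hf.1 hg.1, fun s => by
    rw [coeff_add]; exact natDegree_add_le_of_degree_le (hf.2 s) (hg.2 s)⟩

lemma sum {ι : Type*} {c e : ℕ} (s : Finset ι) (f : ι → ℕ[X][X])
    (h : ∀ i ∈ s, IsBdd c e (f i)) : IsBdd c e (∑ i ∈ s, f i) := by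
  classical
  induction s using Finset.induction_on with
  | empty => simpa using zero c e
  | insert a s ha ih =>
    rw [Finset.sum_insert ha]
    exact (h a (Finset.mem_insert_self _ _)).add
      (ih fun i hi => h i (Finset.mem_insert_of_mem hi))

lemma mul {c e c' e' : ℕ} {f g : ℕ[X][X]} (hf : IsBdd c e f) (hg : IsBdd c' e' g) :
    IsBdd (c + c') (e + e') (f * g) := by
  refine ⟨natDegree_mul_le_of_le hf.1 hg.1, fun s => ?_⟩
  rw [coeff_mul]
  refine natDegree_sum_le_of_forall_le _ _ fun p hp => ?_
  rw [mem_antidiagonal] at hp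
  refine (natDegree_mul_le_of_le (hf.2 p.1) (hg.2 p.2)).trans (by omega)

lemma one : IsBdd 0 0 (1 : ℕ[X][X]) := by
  have := C_mk (c := 0) (a := 1) (by simp) 0
  rwa [Polynomial.C_1] at this

lemma natCast_mul {c e : ℕ} {f : ℕ[X][X]} (hf : IsBdd c e f) (a : ℕ) :
    IsBdd c e ((a : ℕ[X][X]) * f) := by
  have h : IsBdd 0 0 ((a : ℕ[X][X])) := by
    have := C_mk (c := 0) (a := (a : ℕ[X])) (by simp) 0
    rwa [Polynomial.C_eq_natCast] at this
  simpa using h.mul hf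

lemma hx_pow_mul {c e : ℕ} {f : ℕ[X][X]} (hf : IsBdd c e f) (k : ℕ) :
    IsBdd (k + c) e (hx ^ k * f) := by
  have h : IsBdd k 0 (hx ^ k) := by
    rw [hx, ← Polynomial.C_pow]
    exact C_mk (by simp) 0
  simpa using h.mul hf

end IsBdd

lemma coeff_hx_mul_X_mul_succ (f : ℕ[X][X]) (s : ℕ) :
    (hx * X * f).coeff (s + 1) = X * f.coeff s := by
  rw [mul_assoc, coeff_C_mul, coeff_X_mul]

lemma coeff_hx_mul_X_mul_zero (f : ℕ[X][X]) : (hx * X * f).coeff 0 = 0 := by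
  rw [mul_assoc, coeff_C_mul, coeff_X_mul_zero, mul_zero]

/-- The factor raises both degrees by one and so preserves `c`; this is why the bound has the form
`c + s`. -/
lemma IsBdd.hx_mul_X_mul {c e : ℕ} {f : ℕ[X][X]} (hf : IsBdd c e f) :
    IsBdd c (e + 1) (hx * X * f) := by
  constructor
  · rw [mul_assoc]
    refine (natDegree_C_mul_le _ _).trans ?_
    refine (natDegree_mul_le_of_le natDegree_X_le hf.1).trans (by omega)
  · rintro (_ | s)
    · rw [coeff_hx_mul_X_mul_zero]; simp
    · rw [coeff_hx_mul_X_mul_succ]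
      refine (natDegree_mul_le_of_le natDegree_X_le (hf.2 s)).trans (by omega)

lemma isBdd_branch_of_kernel {n : ℕ} (h : ∀ k, IsBdd (2 * n) (2 * n - 2) (kernel n k)) (j : ℕ) :
    IsBdd (2 * n) (2 * n - 1) (branch n j) := by
  rcases eq_or_ne n 0 with rfl | hn
  · rw [branch_zero]; exact IsBdd.one
  rw [branch_of_ne_zero hn]
  exact IsBdd.sum _ _ fun k _ =>
    ((h 0).hx_mul_X_mul.mono le_rfl (by omega)).add ((h k).mono le_rfl (by omega))

lemma isBdd_kernel (n k : ℕ) : IsBdd (2 * n) (2 * n - 2) (kernel n k) := by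
  induction n using Nat.strong_induction_on generalizing k with
  | _ n ih =>
  have hb : ∀ a < n, ∀ j, IsBdd (2 * a) (2 * a - 1) (branch a j) := fun a ha =>
    isBdd_branch_of_kernel (ih a ha)
  match n with
  | 0 => rw [kernel_zero]; exact IsBdd.zero _ _
  | 1 =>
    rw [kernel_one, ← mul_one (hx ^ 2)]
    exact ((IsBdd.one.hx_pow_mul 2).natCast_mul _).mono (by omega) (by omega)
  | m + 2 =>
    rw [kernel_add_two]
    refine IsBdd.add (IsBdd.sum _ _ fun p hp => ?_)
      (IsBdd.sum _ _ fun i hi => IsBdd.sum _ _ fun p hp => ?_)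
    · rw [mem_antidiagonal] at hp
      exact ((hb (p.1 + 1) (by omega) _).mul (ih (p.2 + 1) (by omega) 0).hx_mul_X_mul).mono
        (by omega) (by omega)
    · rw [mem_antidiagonal] at hp
      rw [Finset.mem_range] at hi
      exact (((hb p.1 (by omega) _).mul ((hb p.2 (by omega) _).hx_pow_mul _)).natCast_mul _).mono
        (by omega) (by omega)

lemma isBdd_branch (n j : ℕ) : IsBdd (2 * n) (2 * n - 1) (branch n j) :=
  isBdd_branch_of_kernel (isBdd_kernel n) j

lemma dvd_mul_of_dvd_right_poly {f g : ℕ[X][X]} (h : f ∣ g) (k : ℕ[X][X]) : f ∣ k * g :=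
  Dvd.dvd.mul_left h k

lemma hx_pow_dvd_mul {a b n : ℕ} {f g : ℕ[X][X]} (hf : hx ^ a ∣ f) (hg : hx ^ b ∣ g)
    (h : n ≤ a + b) : hx ^ n ∣ f * g := by
  obtain ⟨c, rfl⟩ := hf
  obtain ⟨d, rfl⟩ := hg
  exact (pow_dvd_pow _ h).trans ⟨c * d, by ring⟩

lemma hx_pow_dvd_branch_of_kernel {n : ℕ} (h : ∀ k, hx ^ n ∣ kernel n k) (j : ℕ) :
    hx ^ n ∣ branch n j := by
  rcases eq_or_ne n 0 with rfl | hn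
  · simp
  rw [branch_of_ne_zero hn]
  exact Finset.dvd_sum fun k _ => dvd_add (dvd_mul_of_dvd_right_poly (h 0) _) (h k)

/-- Reflects that the excess is at most the half-length. It bounds the order of `tupleGF n j`, on
which the passage from excess to number of edges rests. -/
lemma hx_pow_dvd_kernel (n k : ℕ) : hx ^ n ∣ kernel n k := by
  induction n using Nat.strong_induction_on generalizing k with
  | _ n ih =>
  have hb : ∀ a < n, ∀ j, hx ^ a ∣ branch a j := fun a ha =>
    hx_pow_dvd_branch_of_kernel (ih a ha)
  match n with
  | 0 => simp
  | 1 =>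
    rw [kernel_one]
    exact dvd_mul_of_dvd_right_poly (pow_dvd_pow hx (show 1 ≤ 2 by omega)) _
  | m + 2 =>
    rw [kernel_add_two]
    refine dvd_add (Finset.dvd_sum fun p hp => ?_)
      (Finset.dvd_sum fun i hi => Finset.dvd_sum fun p hp => ?_)
    · rw [mem_antidiagonal] at hp
      exact hx_pow_dvd_mul (hb (p.1 + 1) (by omega) (k + 1))
        (dvd_mul_of_dvd_right_poly (ih (p.2 + 1) (by omega) 0) (hx * X)) (by omega)
    · rw [mem_antidiagonal] at hp
      rw [Finset.mem_range] at hi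
      exact dvd_mul_of_dvd_right_poly (hx_pow_dvd_mul (hb p.1 (by omega) (i + 1 + k + 1))
        (hx_pow_dvd_mul (dvd_refl (hx ^ (i + 2))) (hb p.2 (by omega) (i + 2)) le_rfl)
        (by omega)) _

lemma hx_pow_dvd_branch (n j : ℕ) : hx ^ n ∣ branch n j :=
  hx_pow_dvd_branch_of_kernel (hx_pow_dvd_kernel n) j

/-! ### Positivity of the extremal coefficients. -/

/-- The coefficient of `hx ^ a * X ^ s` in `f` is positive. -/
def IsPos (f : ℕ[X][X]) (s a : ℕ) : Prop := 0 < (f.coeff s).coeff a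

namespace IsPos

lemma add_right {f : ℕ[X][X]} {s a : ℕ} (h : IsPos f s a) (g : ℕ[X][X]) : IsPos (f + g) s a := by
  rw [IsPos, coeff_add, coeff_add]
  exact Nat.add_pos_left h _

lemma add_left {f : ℕ[X][X]} {s a : ℕ} (h : IsPos f s a) (g : ℕ[X][X]) : IsPos (g + f) s a := by
  rw [add_comm]; exact h.add_right g

lemma sum {ι : Type*} {t : Finset ι} {f : ι → ℕ[X][X]} {i : ι} (hi : i ∈ t) {s a : ℕ}
    (h : IsPos (f i) s a) : IsPos (∑ i ∈ t, f i) s a := by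
  classical
  rw [← Finset.add_sum_erase t f hi]
  exact h.add_right _

lemma mul {f g : ℕ[X][X]} {s a t b : ℕ} (hf : IsPos f s a) (hg : IsPos g t b) :
    IsPos (f * g) (s + t) (a + b) := by
  rw [IsPos, coeff_mul, finsetSum_coeff]
  refine lt_of_lt_of_le ?_ (Finset.single_le_sum (fun _ _ => Nat.zero_le _)
    (mem_antidiagonal.2 (rfl : (s, t).1 + (s, t).2 = s + t)))
  rw [coeff_mul]
  refine lt_of_lt_of_le ?_ (Finset.single_le_sum (fun _ _ => Nat.zero_le _)
    (mem_antidiagonal.2 (rfl : (a, b).1 + (a, b).2 = a + b)))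
  exact Nat.mul_pos hf hg

lemma hx_pow (k : ℕ) : IsPos (hx ^ k) 0 k := by
  rw [IsPos, hx, ← Polynomial.C_pow, coeff_C_zero, coeff_X_pow_self]
  exact one_pos

lemma hx_mul_X : IsPos (hx * X) 1 1 := by simp [IsPos, hx]

end IsPos

lemma branch_isPos_of_kernel {n k j s a : ℕ} (hn : n ≠ 0) (hk : k < j)
    (h : IsPos (kernel n k) s a) : IsPos (branch n j) s a := by
  rw [branch_of_ne_zero hn]
  exact IsPos.sum (Finset.mem_range.2 hk) (h.add_left _)

lemma branch_isPos_of_kernel_zero {n j s a : ℕ} (hn : n ≠ 0) (hj : 0 < j)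
    (h : IsPos (kernel n 0) s a) : IsPos (branch n j) (1 + s) (1 + a) := by
  rw [branch_of_ne_zero hn]
  exact IsPos.sum (Finset.mem_range.2 hj) ((IsPos.hx_mul_X.mul h).add_right _)

/-- Coefficients in ℕ cannot cancel, so one monomial produced by the recursion suffices. For `s = 0,
1` it comes from a first edge crossed twice each way with all remaining excess beyond it; for `s +
2`, from `branch 1 1` times a chain leading to excess `n + 1`. -/
lemma kernel_isPos (n s : ℕ) (hs : s ≤ 2 * n) :
    IsPos (kernel (n + 1) 0) s (2 * (n + 1) + s) := by
  induction n generalizing s with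
  | zero =>
    obtain rfl : s = 0 := by omega
    rw [zero_add, kernel_one]
    simpa using IsPos.hx_pow 2
  | succ n ih =>
    have hone : IsPos (1 : ℕ[X][X]) 0 0 := by simpa using IsPos.hx_pow 0
    have key : ∀ t a, IsPos (branch (n + 1) 2) t a → IsPos (kernel (n + 2) 0) t (2 + a) := by
      intro t a h
      rw [kernel_add_two]
      refine IsPos.add_left (IsPos.sum (i := 0) (by simp) (IsPos.sum (i := (0, n + 1))
        (by simp) ?_)) _
      rw [branch_zero, Nat.choose_zero_right, Nat.cast_one, one_mul, one_mul]
      simpa using (IsPos.hx_pow 2).mul h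
    match s with
    | 0 =>
      have h1 := key _ _ (branch_isPos_of_kernel (k := 0) (by omega) (by omega)
        (ih 0 (by omega)))
      rwa [show 2 * (n + 1 + 1) + 0 = 2 + (2 * (n + 1) + 0) by ring]
    | 1 =>
      have h1 := key _ _ (branch_isPos_of_kernel_zero (by omega) (by omega) (ih 0 (by omega)))
      rwa [show 2 * (n + 1 + 1) + 1 = 2 + (1 + (2 * (n + 1) + 0)) by ring]
    | s + 2 =>
      have h1 : IsPos (kernel 1 0) 0 2 := by
        rw [kernel_one]
        simpa using IsPos.hx_pow 2
      have h2 := (branch_isPos_of_kernel_zero (j := 1) (by omega) (by omega) h1).mul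
        (IsPos.hx_mul_X.mul (ih s (by omega)))
      rw [show s + 2 = 1 + 0 + (1 + s) by ring,
        show 2 * (n + 1 + 1) + (1 + 0 + (1 + s)) = 1 + 2 + (1 + (2 * (n + 1) + s)) by ring]
      rw [kernel_add_two]
      exact IsPos.add_right (IsPos.sum (i := (0, n)) (by simp) h2) _

/-! ### The two leading coefficients. -/

lemma coeff_mul_second {R : Type*} [Semiring R] {f g : R[X]} {m n : ℕ} (hf : f.natDegree ≤ m + 1)
    (hg : g.natDegree ≤ n + 1) :
    (f * g).coeff (m + n + 1) = f.coeff m * g.coeff (n + 1) + f.coeff (m + 1) * g.coeff n := by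
  rw [coeff_mul, Finset.sum_eq_add (a := (m, n + 1)) (b := (m + 1, n))]
  · simp
  · rintro ⟨a, b⟩ hp hne
    rw [mem_antidiagonal] at hp
    simp only [ne_eq, Prod.mk.injEq, not_and] at hne
    rcases lt_or_ge (m + 1) a with h | h
    · rw [coeff_eq_zero_of_natDegree_lt (lt_of_le_of_lt hf h), zero_mul]
    · rw [coeff_eq_zero_of_natDegree_lt (p := g) (n := b) (by omega), mul_zero]
  · intro h
    exact absurd (mem_antidiagonal.2 (by omega)) h
  · intro h
    exact absurd (mem_antidiagonal.2 (by omega)) h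

lemma coeff_branch_top (n j : ℕ) :
    (branch (n + 1) j).coeff (2 * n + 1) = (j : ℕ[X]) * (X * (kernel (n + 1) 0).coeff (2 * n)) := by
  rw [branch_of_ne_zero (by omega), finsetSum_coeff]
  have h : ∀ k ∈ Finset.range j, (hx * X * kernel (n + 1) 0 + kernel (n + 1) k).coeff (2 * n + 1) =
      X * (kernel (n + 1) 0).coeff (2 * n) := fun k _ => by
    rw [coeff_add, coeff_hx_mul_X_mul_succ, coeff_eq_zero_of_natDegree_lt (p := kernel (n + 1) k),
      add_zero]
    exact lt_of_le_of_lt (isBdd_kernel (n + 1) k).1 (by omega)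
  rw [Finset.sum_congr rfl h]
  simp

lemma coeff_branch_one_second (n : ℕ) :
    (branch (n + 1) 1).coeff (2 * n) =
      (hx * X * kernel (n + 1) 0).coeff (2 * n) + (kernel (n + 1) 0).coeff (2 * n) := by
  rw [branch_of_ne_zero (by omega), Finset.sum_range_one, coeff_add]

lemma natDegree_hx_mul_X_mul_kernel (n : ℕ) :
    (hx * X * kernel (n + 1) 0).natDegree ≤ 2 * n + 1 :=
  (isBdd_kernel (n + 1) 0).hx_mul_X_mul.1.trans (by omega)

lemma natDegree_multiple_term (a b i k : ℕ) :
    (((i + 1 + k).choose k : ℕ[X][X]) *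
      (branch a (i + 1 + k + 1) * (hx ^ (i + 2) * branch b (i + 2)))).natDegree ≤
        (2 * a - 1) + (2 * b - 1) :=
  (((isBdd_branch a _).mul ((isBdd_branch b _).hx_pow_mul (i + 2))).natCast_mul _).1

/-- A first edge crossed at least twice each way loses at least one power of the outer variable
against the bound `2 * m + 2`. -/
lemma coeff_multiple_sum_top (m k : ℕ) :
    (∑ i ∈ Finset.range (m + 2), ∑ p ∈ antidiagonal (m + 1 - i),
        ((i + 1 + k).choose k : ℕ[X][X]) *
          (branch p.1 (i + 1 + k + 1) * (hx ^ (i + 2) * branch p.2 (i + 2)))).coeff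
      (2 * m + 2) = 0 := by
  rw [finsetSum_coeff]
  refine Finset.sum_eq_zero fun i hi => ?_
  rw [finsetSum_coeff]
  refine Finset.sum_eq_zero fun p hp => ?_
  rw [mem_antidiagonal] at hp
  rw [Finset.mem_range] at hi
  exact coeff_eq_zero_of_natDegree_lt
    (lt_of_le_of_lt (natDegree_multiple_term p.1 p.2 i k) (by omega))

/-- Only `i = 0` with all excess on one side of the edge reaches this degree. Each of the two sides
contributes the top term of `branch (m + 1) 2`, whence `2 + 2 = 4`. -/
lemma coeff_multiple_sum_second (m : ℕ) :
    (∑ i ∈ Finset.range (m + 2), ∑ p ∈ antidiagonal (m + 1 - i),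
        ((i + 1 + 0).choose 0 : ℕ[X][X]) *
          (branch p.1 (i + 1 + 0 + 1) * (hx ^ (i + 2) * branch p.2 (i + 2)))).coeff
      (2 * m + 1) = 4 * X ^ 3 * (kernel (m + 1) 0).coeff (2 * m) := by
  rw [finsetSum_coeff, Finset.sum_range_succ', Finset.sum_eq_zero, zero_add, finsetSum_coeff,
    Finset.sum_eq_add (a := (0, m + 1)) (b := (m + 1, 0))]
  · simp only [branch_zero, Nat.choose_zero_right, Nat.cast_one, one_mul, mul_one, zero_add,
      add_zero, Nat.reduceAdd]
    rw [mul_comm (branch (m + 1) 2), hx, ← Polynomial.C_pow, coeff_C_mul, coeff_branch_top]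
    push_cast
    ring
  · simp
  · rintro ⟨a, b⟩ hp hne
    rw [mem_antidiagonal] at hp
    simp only [ne_eq, Prod.mk.injEq, not_and] at hne
    exact coeff_eq_zero_of_natDegree_lt
      (lt_of_le_of_lt (natDegree_multiple_term a b 0 0) (by omega))
  · intro h
    exact absurd (mem_antidiagonal.2 (by omega)) h
  · intro h
    exact absurd (mem_antidiagonal.2 (by omega)) h
  · intro i hi
    rw [finsetSum_coeff]
    refine Finset.sum_eq_zero fun p hp => ?_
    rw [mem_antidiagonal] at hp
    rw [Finset.mem_range] at hi
    exact coeff_eq_zero_of_natDegree_lt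
      (lt_of_le_of_lt (natDegree_multiple_term p.1 p.2 (i + 1) 0) (by omega))

lemma coeff_kernel_top (n : ℕ) :
    (kernel (n + 1) 0).coeff (2 * n) = Polynomial.C (catalan n) * X ^ (4 * n + 2) := by
  induction n using Nat.strong_induction_on with
  | _ n ih =>
  match n with
  | 0 =>
    rw [zero_add, kernel_one, hx, ← Polynomial.C_pow, add_zero, Nat.choose_zero_right, Nat.cast_one,
      one_mul, mul_zero, coeff_C_zero, catalan_zero]
    simp
  | m + 1 =>
    rw [kernel_add_two, coeff_add, show 2 * (m + 1) = 2 * m + 2 by ring, coeff_multiple_sum_top,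
      add_zero, finsetSum_coeff, catalan_succ', map_sum, Finset.sum_mul]
    refine Finset.sum_congr rfl fun p hp => ?_
    rw [mem_antidiagonal] at hp
    rw [show 2 * m + 2 = (2 * p.1 + 1) + (2 * p.2 + 1) by omega,
      coeff_mul_add_eq_of_natDegree_le ((isBdd_branch (p.1 + 1) _).1.trans (by omega))
        (natDegree_hx_mul_X_mul_kernel p.2), coeff_branch_top, coeff_hx_mul_X_mul_succ,
      ih _ (by omega), ih _ (by omega), ← hp, Polynomial.C_mul]
    push_cast
    ring

/-- The coefficients of the second leading terms of the kernel polynomials, set to zero where there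
is no such term. -/
def secondCoeff (b : ℕ) : ℕ := if b = 0 then 0 else (3 * b + 2) * catalan b

/-- With `(3 * b + 2) * catalan b` in place of `secondCoeff b` the weights add up to `3 * m + 5`,
and Catalan convolution applies. The convention at `b = 0` loses `2 * catalan m` in each factor,
which the term `4 * catalan m` restores. -/
lemma sum_catalan_mul_secondCoeff (m : ℕ) :
    (∑ p ∈ antidiagonal m, ((secondCoeff p.1 + catalan p.1) * catalan p.2 +
      catalan p.1 * secondCoeff p.2)) + 4 * catalan m = (3 * m + 5) * catalan (m + 1) := by
  have h1 : ∀ b, secondCoeff b + (if b = 0 then 2 else 0) = (3 * b + 2) * catalan b := by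
    intro b
    rw [secondCoeff]
    split_ifs with h
    · subst h; simp
    · simp
  have h2 : ∑ p ∈ antidiagonal m, (catalan p.1 * if p.2 = 0 then 2 else 0) = 2 * catalan m := by
    rw [Finset.sum_eq_single (m, 0)]
    · simp; ring
    · rintro ⟨a, b⟩ hp hne
      rw [mem_antidiagonal] at hp
      rw [if_neg, mul_zero]
      rintro rfl
      simp at hp
      simp [hp] at hne
    · simp
  have h3 : ∑ p ∈ antidiagonal m, ((if p.1 = 0 then 2 else 0) * catalan p.2) =
      2 * catalan m := by
    rw [← h2, ← Finset.Nat.sum_antidiagonal_swap]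
    exact Finset.sum_congr rfl fun p _ => by simp [mul_comm]
  have h4 : (3 * m + 5) * catalan (m + 1) =
      ∑ p ∈ antidiagonal m, (((3 * p.1 + 2) * catalan p.1 + catalan p.1) * catalan p.2 +
        catalan p.1 * ((3 * p.2 + 2) * catalan p.2)) := by
    rw [catalan_succ', Finset.mul_sum]
    refine Finset.sum_congr rfl fun p hp => ?_
    rw [mem_antidiagonal] at hp
    rw [← hp]
    ring
  rw [h4, show 4 * catalan m = 2 * catalan m + 2 * catalan m by ring]
  nth_rewrite 1 [← h2]
  rw [← h3, ← Finset.sum_add_distrib, ← Finset.sum_add_distrib]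
  refine Finset.sum_congr rfl fun p _ => ?_
  rw [← h1, ← h1]
  ring

lemma coeff_kernel_second (n : ℕ) :
    (kernel (n + 2) 0).coeff (2 * n + 1) =
      Polynomial.C ((3 * n + 5) * catalan (n + 1)) * X ^ (4 * n + 5) := by
  induction n using Nat.strong_induction_on with
  | _ m ih =>
  have hs : ∀ b ≤ m, (hx * X * kernel (b + 1) 0).coeff (2 * b) =
      Polynomial.C (secondCoeff b) * X ^ (4 * b + 2) := by
    rintro (_ | b) hb
    · rw [mul_zero, coeff_hx_mul_X_mul_zero]
      simp [secondCoeff]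
    · rw [show 2 * (b + 1) = (2 * b + 1) + 1 by ring, coeff_hx_mul_X_mul_succ, ih b (by omega),
        secondCoeff, if_neg (by omega), show 3 * (b + 1) + 2 = 3 * b + 5 by ring]
      ring
  rw [kernel_add_two, coeff_add, coeff_multiple_sum_second, finsetSum_coeff,
    ← sum_catalan_mul_secondCoeff, Polynomial.C_add, map_sum, add_mul, Finset.sum_mul]
  refine congrArg₂ (· + ·) (Finset.sum_congr rfl fun p hp => ?_) ?_
  · rw [mem_antidiagonal] at hp
    rw [show 2 * m + 1 = 2 * p.1 + 2 * p.2 + 1 by omega,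
      coeff_mul_second ((isBdd_branch (p.1 + 1) _).1.trans (by omega))
        (natDegree_hx_mul_X_mul_kernel p.2), zero_add, coeff_branch_one_second, coeff_branch_top,
      coeff_hx_mul_X_mul_succ, hs p.1 (by omega), hs p.2 (by omega), coeff_kernel_top,
      coeff_kernel_top, ← hp]
    simp only [Polynomial.C_add, Polynomial.C_mul]
    push_cast
    ring
  · rw [coeff_kernel_top, Polynomial.C_mul, map_ofNat]
    ring

/-! ### Evaluation at `zC²` and `1 / (1 - zC²)`. -/

open PowerSeries

lemma catalanGF_eq : catalanGF = 1 + PowerSeries.X * catalanGF ^ 2 := by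
  have h := congrArg (PowerSeries.map (Nat.castRingHom ℚ)) catalanSeries_sq_mul_X_add_one
  simp only [map_add, map_mul, map_pow, map_one, PowerSeries.map_X] at h
  rw [← catalanGF] at h
  rw [add_comm, mul_comm PowerSeries.X]
  exact h.symm

/-- The power series substituted for the variable `hx`. -/
noncomputable def coreVar : PowerSeries ℚ := PowerSeries.X * catalanGF ^ 2

lemma constantCoeff_one_sub_coreVar : PowerSeries.constantCoeff (1 - coreVar) ≠ 0 := by
  simp [coreVar]

lemma catalanGF_eq_one_add_coreVar : catalanGF = 1 + coreVar := catalanGF_eq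

/-- The evaluation of the kernel polynomials at the power series marking the core walks and the
chains of edges traversed twice. -/
noncomputable def evalCore : Polynomial (Polynomial ℕ) →+* PowerSeries ℚ :=
  Polynomial.eval₂RingHom (Polynomial.eval₂RingHom (Nat.castRingHom _) coreVar) (1 - coreVar)⁻¹

@[simp] lemma evalCore_hx : evalCore hx = coreVar := by simp [evalCore]

@[simp] lemma evalCore_X : evalCore Polynomial.X = (1 - coreVar)⁻¹ := by simp [evalCore]

lemma coreVar_mul_inv_add_one : coreVar * (1 - coreVar)⁻¹ + 1 = (1 - coreVar)⁻¹ := by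
  have h := PowerSeries.mul_inv_cancel _ constantCoeff_one_sub_coreVar
  linear_combination (-1 : PowerSeries ℚ) * h

lemma evalCore_branch_one {n : ℕ} (hn : n ≠ 0) :
    evalCore (branch n 1) = (1 - coreVar)⁻¹ * evalCore (kernel n 0) := by
  rw [branch_of_ne_zero hn, Finset.sum_range_one, map_add, map_mul, map_mul, evalCore_hx,
    evalCore_X]
  linear_combination evalCore (kernel n 0) * coreVar_mul_inv_add_one

lemma evalCore_block_zero (n : ℕ) :
    evalCore (block n 0) + (if n = 0 then coreVar else 0) =
      coreVar * evalCore (branch n 1) := by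
  split_ifs with hn
  · subst hn
    rw [block_zero, kernel_zero, mul_zero, map_zero, branch_zero, map_one]
    ring
  · rw [evalCore_branch_one hn, block_zero, map_mul, map_mul, evalCore_hx, evalCore_X]
    ring

/-- Since `C = 1 + x`, the extra `x * branch n (k + 1)` supplies the term with `i = 0` and no excess
behind the edge, which `block` omits. -/
lemma evalCore_branch_succ (n k : ℕ) :
    catalanGF * evalCore (branch n (k + 1)) = evalCore (branch n k) +
      ∑ i ∈ Finset.range (n + 1), ∑ p ∈ antidiagonal (n - i),
        ((i + k).choose k : PowerSeries ℚ) * (evalCore (branch p.1 (i + k + 1)) *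
          (coreVar ^ (i + 1) * evalCore (branch p.2 (i + 1)))) := by
  have h1 := congrArg evalCore (branch_succ n k)
  simp only [map_add, map_sum, map_mul, map_natCast] at h1
  have h0 : coreVar * evalCore (branch n (k + 1)) = ∑ p ∈ antidiagonal n,
      evalCore (branch p.1 (k + 1)) * (if p.2 = 0 then coreVar else 0) := by
    rw [Finset.sum_eq_single (n, 0)]
    · rw [if_pos rfl, mul_comm]
    · rintro ⟨a, b⟩ hp hne
      rw [mem_antidiagonal] at hp
      rw [if_neg, mul_zero]
      rintro rfl
      exact hne (by rw [← hp, add_zero])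
    · intro h
      exact absurd (mem_antidiagonal.2 (add_zero n)) h
  rw [catalanGF_eq_one_add_coreVar, add_mul, one_mul, h0]
  nth_rewrite 1 [h1]
  rw [add_assoc]
  refine congrArg (evalCore (branch n k) + ·) ?_
  rw [Finset.sum_range_succ', Finset.sum_range_succ', add_assoc]
  refine congrArg₂ (· + ·) (Finset.sum_congr rfl fun i hi => ?_) ?_
  · rw [Finset.mem_range] at hi
    refine Eq.trans (Finset.sum_congr rfl fun p _ => ?_)
      (sum_antidiagonal_ite_le (fun a b => ((i + 1 + k).choose k : PowerSeries ℚ) *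
        (evalCore (branch a (i + 1 + k + 1)) *
          (coreVar ^ (i + 1 + 1) * evalCore (branch b (i + 1 + 1)))))
        (show i + 1 ≤ n by omega))
    rw [block_succ]
    split_ifs
    · rw [map_mul, map_pow, evalCore_hx]
    · rw [map_zero, mul_zero, mul_zero]
  · rw [← Finset.sum_add_distrib, Nat.sub_zero]
    refine Finset.sum_congr rfl fun p _ => ?_
    rw [zero_add, zero_add, Nat.choose_self, Nat.cast_one, pow_one]
    linear_combination evalCore (branch p.1 (k + 1)) * evalCore_block_zero p.2

/-- The generating function of the `j`-tuples of closed walks of total excess `n`. -/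
noncomputable def tupleGF (n j : ℕ) : PowerSeries ℚ := catalanGF ^ j * evalCore (branch n j)

/-- The walk recursion in terms of excess. The powers of `C` match because `(zC²) ^ (i + 1) * C ^ k`
equals `z ^ (i + 1) * C ^ (i + k + 1) * C ^ (i + 1)`. -/
lemma tupleGF_succ (n k : ℕ) :
    tupleGF n (k + 1) = tupleGF n k +
      ∑ i ∈ Finset.range (n + 1), ∑ p ∈ antidiagonal (n - i),
        ((i + k).choose k : PowerSeries ℚ) *
          (PowerSeries.X ^ (i + 1) * (tupleGF p.1 (i + k + 1) * tupleGF p.2 (i + 1))) := by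
  rw [tupleGF, pow_succ, mul_assoc, evalCore_branch_succ, mul_add, Finset.mul_sum]
  refine congrArg (tupleGF n k + ·) (Finset.sum_congr rfl fun i _ => ?_)
  rw [Finset.mul_sum]
  refine Finset.sum_congr rfl fun p _ => ?_
  rw [tupleGF, tupleGF, coreVar]
  ring

lemma X_pow_dvd_tupleGF (n j : ℕ) : PowerSeries.X ^ n ∣ tupleGF n j := by
  have h := map_dvd evalCore (hx_pow_dvd_branch n j)
  rw [map_pow, evalCore_hx, coreVar, mul_pow] at h
  exact Dvd.dvd.mul_left ((Dvd.intro _ rfl).trans h) _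

lemma coeff_tupleGF_of_lt {l n : ℕ} (h : l < n) (j : ℕ) : PowerSeries.coeff l (tupleGF n j) = 0 :=
  PowerSeries.X_pow_dvd_iff.1 (X_pow_dvd_tupleGF n j) l h

/-! ### Regrouping by number of edges instead of excess. -/

/-- The generating function of the `j`-tuples of closed walks spanning a tree with `e` edges. -/
noncomputable def edgeGF (j e : ℕ) : PowerSeries ℚ :=
  PowerSeries.mk fun l => if e ≤ l then PowerSeries.coeff l (tupleGF (l - e) j) else 0

lemma X_pow_dvd_edgeGF (j e : ℕ) : PowerSeries.X ^ e ∣ edgeGF j e :=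
  PowerSeries.X_pow_dvd_iff.2 fun m hm => by rw [edgeGF, coeff_mk, if_neg (by omega)]

/-- At fixed half-lengths, subtraction exchanges edge counts and excesses; the vanishing hypotheses
discard the pairs that have no partner. -/
lemma sum_antidiagonal_reflect {u v : ℕ → ℚ} {l₁ l₂ A B : ℕ} (h : A + B = l₁ + l₂)
    (hu : ∀ a, l₁ < a → u a = 0) (hv : ∀ b, l₂ < b → v b = 0) :
    ∑ p ∈ antidiagonal A, (if p.1 ≤ l₁ then u (l₁ - p.1) else 0) *
      (if p.2 ≤ l₂ then v (l₂ - p.2) else 0) = ∑ p ∈ antidiagonal B, u p.1 * v p.2 := by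
  have h1 : ∑ p ∈ antidiagonal A, (if p.1 ≤ l₁ then u (l₁ - p.1) else 0) *
      (if p.2 ≤ l₂ then v (l₂ - p.2) else 0) =
      ∑ p ∈ antidiagonal A with p.1 ≤ l₁ ∧ p.2 ≤ l₂, u (l₁ - p.1) * v (l₂ - p.2) := by
    rw [Finset.sum_filter]
    refine Finset.sum_congr rfl fun p _ => ?_
    by_cases h1 : p.1 ≤ l₁ <;> by_cases h2 : p.2 ≤ l₂ <;> simp [h1, h2]
  have h2 : ∑ p ∈ antidiagonal B, u p.1 * v p.2 =
      ∑ p ∈ antidiagonal B with p.1 ≤ l₁ ∧ p.2 ≤ l₂, u p.1 * v p.2 := by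
    rw [Finset.sum_filter]
    refine Finset.sum_congr rfl fun p _ => ?_
    split_ifs with hp
    · rfl
    · rcases lt_or_ge l₁ p.1 with h1 | h1
      · rw [hu _ h1, zero_mul]
      · rw [hv _ (by omega), mul_zero]
  rw [h1, h2]
  refine Finset.sum_bij' (fun p _ => (l₁ - p.1, l₂ - p.2)) (fun p _ => (l₁ - p.1, l₂ - p.2))
    ?_ ?_ ?_ ?_ ?_
  · rintro ⟨a, b⟩ hp
    simp only [Finset.mem_filter, mem_antidiagonal] at hp ⊢
    omega
  · rintro ⟨a, b⟩ hp
    simp only [Finset.mem_filter, mem_antidiagonal] at hp ⊢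
    omega
  · rintro ⟨a, b⟩ hp
    simp only [Finset.mem_filter, mem_antidiagonal] at hp
    simp only [Prod.mk.injEq]
    omega
  · rintro ⟨a, b⟩ hp
    simp only [Finset.mem_filter, mem_antidiagonal] at hp
    simp only [Prod.mk.injEq]
    omega
  · intros; rfl

lemma coeff_sum_edgeGF_mul {e n L : ℕ} (h : e + n = L) (a b : ℕ) :
    PowerSeries.coeff L (∑ p ∈ antidiagonal e, edgeGF a p.1 * edgeGF b p.2) =
      PowerSeries.coeff L (∑ p ∈ antidiagonal n, tupleGF p.1 a * tupleGF p.2 b) := by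
  simp only [map_sum, PowerSeries.coeff_mul]
  rw [Finset.sum_comm, Finset.sum_comm (s := antidiagonal n)]
  refine Finset.sum_congr rfl fun q hq => ?_
  rw [mem_antidiagonal] at hq
  simp only [edgeGF, coeff_mk]
  exact sum_antidiagonal_reflect (u := fun a' => PowerSeries.coeff q.1 (tupleGF a' a))
    (v := fun b' => PowerSeries.coeff q.2 (tupleGF b' b)) (h.trans hq.symm)
    (fun _ h => coeff_tupleGF_of_lt h a) (fun _ h => coeff_tupleGF_of_lt h b)

lemma coeff_sum_edgeGF_mul_of_lt {e L : ℕ} (h : L < e) (a b : ℕ) :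
    PowerSeries.coeff L (∑ p ∈ antidiagonal e, edgeGF a p.1 * edgeGF b p.2) = 0 := by
  refine PowerSeries.X_pow_dvd_iff.1 (Finset.dvd_sum fun p hp => ?_) L h
  rw [mem_antidiagonal] at hp
  rw [← hp, pow_add]
  exact mul_dvd_mul (X_pow_dvd_edgeGF _ _) (X_pow_dvd_edgeGF _ _)

/-- For fixed `e` the multiplicity `i` is unbounded, so the infinite sum is stated modulo `X ^ N`.
-/
lemma edgeGF_succ_succ (k e N : ℕ) :
    PowerSeries.X ^ N ∣ edgeGF (k + 1) (e + 1) - (edgeGF k (e + 1) + ∑ i ∈ Finset.range N,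
      ((i + k).choose k : PowerSeries ℚ) *
        (PowerSeries.X ^ (i + 1) *
          ∑ p ∈ antidiagonal e, edgeGF (i + k + 1) p.1 * edgeGF (i + 1) p.2)) := by
  refine PowerSeries.X_pow_dvd_iff.2 fun l hl => ?_
  rw [map_sub, sub_eq_zero, map_add, map_sum]
  have hc : ∀ (a : ℕ) (f : PowerSeries ℚ),
      PowerSeries.coeff l ((a : PowerSeries ℚ) * f) = a * PowerSeries.coeff l f := by
    intro a f
    rw [← map_natCast (PowerSeries.C (R := ℚ)), PowerSeries.coeff_C_mul]
  simp only [hc, PowerSeries.coeff_X_pow_mul']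
  by_cases h : e + 1 ≤ l
  · rw [edgeGF, coeff_mk, if_pos h, edgeGF, coeff_mk, if_pos h, tupleGF_succ, map_add, map_sum]
    refine congrArg (PowerSeries.coeff l (tupleGF (l - (e + 1)) k) + ·) ?_
    -- Here `l - (e + 1)` is the excess. Terms with larger `i` have order above `l` and vanish.
    refine Eq.trans (Finset.sum_congr rfl fun i hi => ?_)
      (Finset.sum_subset (Finset.range_subset_range.2
        (show l - (e + 1) + 1 ≤ N by omega)) fun i _ hi => ?_)
    · rw [Finset.mem_range] at hi
      rw [if_pos (by omega), coeff_sum_edgeGF_mul (n := l - (e + 1) - i) (by omega),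
        ← Finset.mul_sum, hc, ← Finset.mul_sum, PowerSeries.coeff_X_pow_mul', if_pos (by omega)]
    · rw [Finset.mem_range] at hi
      split_ifs with h1
      · rw [coeff_sum_edgeGF_mul_of_lt (by omega), mul_zero]
      · rw [mul_zero]
  · rw [edgeGF, coeff_mk, if_neg h, edgeGF, coeff_mk, if_neg h, zero_add]
    refine (Finset.sum_eq_zero fun i _ => ?_).symm
    split_ifs with h1
    · rw [coeff_sum_edgeGF_mul_of_lt (by omega), mul_zero]
    · rw [mul_zero]

lemma tupleGF_zero (n : ℕ) : tupleGF n 0 = if n = 0 then 1 else 0 := by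
  rw [tupleGF]
  split_ifs with h
  · subst h; simp
  · rw [branch_of_ne_zero h]; simp

lemma edgeGF_zero_succ (e : ℕ) : edgeGF 0 (e + 1) = 0 := by
  ext l
  rw [edgeGF, coeff_mk, map_zero]
  split_ifs with h
  · rw [tupleGF_zero]
    split_ifs
    · rw [PowerSeries.coeff_one, if_neg (by omega)]
    · rw [map_zero]
  · rfl

lemma edgeGF_zero_right (j : ℕ) : edgeGF j 0 = 1 := by
  induction j with
  | zero =>
    ext l
    rw [edgeGF, coeff_mk, if_pos (Nat.zero_le l), tupleGF_zero]
    simp only [Nat.sub_zero]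
    split_ifs with h
    · rfl
    · rw [PowerSeries.coeff_one, if_neg h, map_zero]
  | succ k ih =>
    rw [← ih]
    ext l
    rw [edgeGF, coeff_mk, if_pos (Nat.zero_le l), edgeGF, coeff_mk, if_pos (Nat.zero_le l),
      Nat.sub_zero, tupleGF_succ, map_add, add_eq_left, map_sum]
    refine Finset.sum_eq_zero fun i hi => ?_
    rw [Finset.mem_range] at hi
    rw [map_sum]
    refine Finset.sum_eq_zero fun p hp => ?_
    rw [mem_antidiagonal] at hp
    refine (PowerSeries.X_pow_dvd_iff (n := l + 1)).1 ?_ l (by omega)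
    refine Dvd.dvd.mul_left ?_ _
    rw [show l + 1 = (i + 1) + (p.1 + p.2) by omega, pow_add, pow_add PowerSeries.X p.1]
    exact mul_dvd_mul (dvd_refl _) (mul_dvd_mul (X_pow_dvd_tupleGF _ _) (X_pow_dvd_tupleGF _ _))

/-! ### The numerators of the partial fraction expansion. -/

lemma inv_pow_one_sub_coreVar (s : ℕ) :
    ((1 - coreVar) ^ s)⁻¹ = ((1 - coreVar)⁻¹) ^ s := by
  symm
  rw [PowerSeries.eq_inv_iff_mul_eq_one (by
    rw [map_pow]; exact pow_ne_zero _ constantCoeff_one_sub_coreVar), ← mul_pow,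
    PowerSeries.inv_mul_cancel _ constantCoeff_one_sub_coreVar, one_pow]

lemma evalCore_C (a : Polynomial ℕ) :
    evalCore (Polynomial.C a) = Polynomial.aeval coreVar (a.map (Nat.castRingHom ℚ)) := by
  rw [evalCore, Polynomial.coe_eval₂RingHom, Polynomial.eval₂_C, Polynomial.coe_eval₂RingHom,
    Polynomial.aeval_def, Polynomial.eval₂_map]
  congr 1

/-- The numerators of the partial fraction expansion of the generating function of the tree walks
of excess `n`. -/
noncomputable def kernelNumerator (n s : ℕ) : Polynomial ℚ :=
  ((kernel n 0).coeff s).map (Nat.castRingHom ℚ)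

lemma tupleGF_one_eq_sum {n : ℕ} (hn : n ≠ 0) :
    tupleGF n 1 = catalanGF * ∑ s ∈ Finset.range (2 * n - 2 + 1),
      Polynomial.aeval coreVar (kernelNumerator n s) * ((1 - coreVar) ^ (s + 1))⁻¹ := by
  rw [tupleGF, pow_one, evalCore_branch_one hn,
    (kernel n 0).as_sum_range_C_mul_X_pow' (Nat.lt_succ_of_le (isBdd_kernel n 0).1), map_sum,
    Finset.mul_sum]
  refine congrArg (catalanGF * ·) (Finset.sum_congr rfl fun s _ => ?_)
  rw [map_mul, map_pow, evalCore_X, evalCore_C, inv_pow_one_sub_coreVar, kernelNumerator]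
  ring

lemma kernelNumerator_coeff_nonneg (n s i : ℕ) : 0 ≤ (kernelNumerator n s).coeff i := by
  rw [kernelNumerator, Polynomial.coeff_map]
  exact Nat.cast_nonneg _

lemma degree_kernelNumerator {n s : ℕ} (hn : 1 ≤ n) (hs : s ≤ 2 * n - 2) :
    (kernelNumerator n s).degree = ((2 * n + s : ℕ) : WithBot ℕ) := by
  obtain ⟨m, rfl⟩ : ∃ m, n = m + 1 := ⟨n - 1, by omega⟩
  refine Polynomial.degree_eq_of_le_of_coeff_ne_zero
    (Polynomial.degree_le_of_natDegree_le
      (Polynomial.natDegree_map_le.trans ((isBdd_kernel (m + 1) 0).2 s))) ?_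
  rw [kernelNumerator, Polynomial.coeff_map]
  exact Nat.cast_ne_zero.2 (kernel_isPos m s (by omega)).ne'

lemma kernelNumerator_top {n : ℕ} (hn : 1 ≤ n) :
    kernelNumerator n (2 * n - 2) =
      Polynomial.C (catalan (n - 1) : ℚ) * Polynomial.X ^ (4 * n - 2) := by
  obtain ⟨m, rfl⟩ : ∃ m, n = m + 1 := ⟨n - 1, by omega⟩
  rw [kernelNumerator, show 2 * (m + 1) - 2 = 2 * m by omega, coeff_kernel_top,
    show 4 * (m + 1) - 2 = 4 * m + 2 by omega]
  simp

lemma kernelNumerator_second {n : ℕ} (hn : 2 ≤ n) :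
    kernelNumerator n (2 * n - 3) =
      Polynomial.C ((3 * (n : ℚ) - 1) * (catalan (n - 1) : ℚ)) * Polynomial.X ^ (4 * n - 3) := by
  obtain ⟨m, rfl⟩ : ∃ m, n = m + 2 := ⟨n - 2, by omega⟩
  rw [kernelNumerator, show 2 * (m + 2) - 3 = 2 * m + 1 by omega, coeff_kernel_second,
    show 4 * (m + 2) - 3 = 4 * m + 5 by omega, Polynomial.map_mul, Polynomial.map_pow,
    Polynomial.map_X, Polynomial.map_C, show m + 2 - 1 = m + 1 by omega]
  congr 2
  push_cast
  simp
  ring_nf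
  simp

/-! ### Walk generating functions as resolvents. -/

section Resolvent

variable {V : Type*} [DecidableEq V]

/-- The adjacency matrix of the graph with edge set `H`. -/
def edgeAdj (H : Finset (Sym2 V)) : Matrix V V ℚ :=
  Matrix.of fun u v => if s(u, v) ∈ H then 1 else 0

/-- The matrix of the generating functions of the walks of length one. -/
noncomputable def stepMatrix (H : Finset (Sym2 V)) : Matrix V V (PowerSeries ℚ) :=
  Matrix.of fun u v => if s(u, v) ∈ H then PowerSeries.X else 0

lemma stepMatrix_insert {H : Finset (Sym2 V)} {r v : V} (hrv : r ≠ v) (h : s(r, v) ∉ H) :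
    stepMatrix (insert s(r, v) H) = stepMatrix H +
      (Matrix.single r v PowerSeries.X + Matrix.single v r PowerSeries.X) := by
  ext1 a b
  have h' : s(v, r) ∉ H := by rwa [Sym2.eq_swap]
  simp only [stepMatrix, Matrix.of_apply, Matrix.add_apply, Matrix.single_apply,
    Finset.mem_insert, Sym2.eq_iff]
  by_cases h1 : a = r ∧ b = v
  · obtain ⟨rfl, rfl⟩ := h1
    simp [h, hrv, hrv.symm]
  · by_cases h2 : a = v ∧ b = r
    · obtain ⟨rfl, rfl⟩ := h2
      simp [h', hrv, hrv.symm]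
    · have h3 : ¬ (r = a ∧ v = b) := fun h => h1 ⟨h.1.symm, h.2.symm⟩
      have h4 : ¬ (v = a ∧ r = b) := fun h => h2 ⟨h.1.symm, h.2.symm⟩
      simp [h1, h2, h3, h4]

variable [Fintype V]

/-- The generating function of the walks from `u` to `v` that use only edges in `H`. -/
noncomputable def walkGF (H : Finset (Sym2 V)) (u v : V) : PowerSeries ℚ :=
  PowerSeries.mk fun n => (edgeAdj H ^ n) u v

/-- The matrix of the generating functions of walks. -/
noncomputable def walkMatrix (H : Finset (Sym2 V)) : Matrix V V (PowerSeries ℚ) :=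
  Matrix.of fun u v => walkGF H u v

lemma walkGF_first_step (H : Finset (Sym2 V)) (u v : V) :
    walkGF H u v = (if u = v then 1 else 0) +
      ∑ w, if s(u, w) ∈ H then PowerSeries.X * walkGF H w v else 0 := by
  ext n
  rw [map_add, map_sum, walkGF, coeff_mk]
  cases n with
  | zero =>
    rw [Finset.sum_eq_zero, add_zero, pow_zero, Matrix.one_apply]
    · split_ifs <;> simp
    · intro w _
      split_ifs <;> simp
  | succ n =>
    rw [pow_succ', Matrix.mul_apply]
    have h : PowerSeries.coeff (n + 1) (if u = v then (1 : PowerSeries ℚ) else 0) = 0 := by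
      split_ifs
      · rw [PowerSeries.coeff_one, if_neg (by omega)]
      · rw [map_zero]
    rw [h, zero_add]
    refine Finset.sum_congr rfl fun w _ => ?_
    rw [edgeAdj, Matrix.of_apply]
    split_ifs
    · rw [PowerSeries.coeff_succ_X_mul, walkGF, coeff_mk, one_mul]; rfl
    · rw [map_zero, zero_mul]

lemma walkGF_last_step (H : Finset (Sym2 V)) (u v : V) :
    walkGF H u v = (if u = v then 1 else 0) +
      ∑ w, if s(w, v) ∈ H then walkGF H u w * PowerSeries.X else 0 := by
  ext n
  rw [map_add, map_sum, walkGF, coeff_mk]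
  cases n with
  | zero =>
    rw [Finset.sum_eq_zero, add_zero, pow_zero, Matrix.one_apply]
    · split_ifs <;> simp
    · intro w _
      split_ifs <;> simp
  | succ n =>
    rw [pow_succ, Matrix.mul_apply]
    have h : PowerSeries.coeff (n + 1) (if u = v then (1 : PowerSeries ℚ) else 0) = 0 := by
      split_ifs
      · rw [PowerSeries.coeff_one, if_neg (by omega)]
      · rw [map_zero]
    rw [h, zero_add]
    refine Finset.sum_congr rfl fun w _ => ?_
    rw [edgeAdj, Matrix.of_apply]
    split_ifs
    · rw [PowerSeries.coeff_succ_mul_X, walkGF, coeff_mk, mul_one]; rfl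
    · rw [map_zero, mul_zero]

lemma one_sub_stepMatrix_mul_walkMatrix (H : Finset (Sym2 V)) :
    (1 - stepMatrix H) * walkMatrix H = 1 := by
  rw [sub_mul, one_mul, sub_eq_iff_eq_add]
  ext1 u v
  rw [Matrix.add_apply, Matrix.mul_apply, Matrix.one_apply, walkMatrix, Matrix.of_apply,
    walkGF_first_step]
  simp [stepMatrix, ite_mul]

lemma walkMatrix_mul_one_sub_stepMatrix (H : Finset (Sym2 V)) :
    walkMatrix H * (1 - stepMatrix H) = 1 := by
  rw [mul_sub, mul_one, sub_eq_iff_eq_add]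
  ext1 u v
  rw [Matrix.add_apply, Matrix.mul_apply, Matrix.one_apply, walkMatrix, Matrix.of_apply,
    walkGF_last_step]
  simp [stepMatrix, mul_ite]

/-- The resolvent identity `R' = R + R E R'`, where `E` is the contribution of the new edge: the
walk is cut at its first use of that edge. -/
lemma walkGF_insert {H : Finset (Sym2 V)} {r v : V} (hrv : r ≠ v) (h : s(r, v) ∉ H) (a b : V) :
    walkGF (insert s(r, v) H) a b = walkGF H a b +
      PowerSeries.X * (walkGF H a r * walkGF (insert s(r, v) H) v b +
        walkGF H a v * walkGF (insert s(r, v) H) r b) := by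
  have key : walkMatrix (insert s(r, v) H) = walkMatrix H + walkMatrix H *
      ((Matrix.single r v PowerSeries.X + Matrix.single v r PowerSeries.X) *
        walkMatrix (insert s(r, v) H)) := by
    have h1 := one_sub_stepMatrix_mul_walkMatrix (insert s(r, v) H)
    have h2 := walkMatrix_mul_one_sub_stepMatrix H
    rw [stepMatrix_insert hrv h] at h1
    set E : Matrix V V (PowerSeries ℚ) :=
      Matrix.single r v PowerSeries.X + Matrix.single v r PowerSeries.X
    set R := walkMatrix (insert s(r, v) H)
    calc R = (walkMatrix H * (1 - stepMatrix H)) * R := by rw [h2, one_mul]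
      _ = walkMatrix H * ((1 - (stepMatrix H + E)) * R) + walkMatrix H * (E * R) := by
        noncomm_ring
      _ = _ := by rw [h1, mul_one]
  have h3 := congrFun (congrFun key a) b
  rw [Matrix.add_apply, Matrix.mul_apply] at h3
  rw [show walkGF (insert s(r, v) H) a b = walkMatrix (insert s(r, v) H) a b from rfl, h3]
  refine congrArg (walkGF H a b + ·) ?_
  have hs : ∀ (c d : V), ∑ j, walkMatrix H a j *
      (Matrix.single c d PowerSeries.X * walkMatrix (insert s(r, v) H) :
        Matrix V V (PowerSeries ℚ)) j b =
        PowerSeries.X * (walkGF H a c * walkGF (insert s(r, v) H) d b) := by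
    intro c d
    rw [Finset.sum_eq_single c]
    · rw [Matrix.single_mul_apply_same]
      simp only [walkMatrix, Matrix.of_apply]
      ring
    · intro j _ hj
      rw [Matrix.single_mul_apply_of_ne _ _ _ _ _ hj, mul_zero]
    · simp
  simp only [add_mul, Matrix.add_apply, mul_add, Finset.sum_add_distrib, hs]

end Resolvent

/-! ### Truncated negative binomial expansion. -/

lemma one_sub_mul_sum_choose {R : Type*} [CommRing R] (u : R) (k N : ℕ) :
    (1 - u) * ∑ i ∈ Finset.range N, ((i + (k + 1)).choose (k + 1) : R) * u ^ i =
      (∑ i ∈ Finset.range N, ((i + k).choose k : R) * u ^ i) -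
        ((N + k).choose (k + 1) : R) * u ^ N := by
  induction N with
  | zero => simp
  | succ N ih =>
    rw [Finset.sum_range_succ, mul_add, ih, Finset.sum_range_succ]
    have h : ((N + (k + 1)).choose (k + 1) : R) = (N + k).choose k + (N + k).choose (k + 1) := by
      rw [← Nat.cast_add, ← Nat.choose_succ_succ]; rfl
    rw [show N + 1 + k = N + (k + 1) by ring, h]
    ring

lemma pow_dvd_one_sub_pow_mul_sum_choose {R : Type*} [CommRing R] (u : R) (k N : ℕ) :
    u ^ N ∣ (1 - u) ^ (k + 1) * (∑ i ∈ Finset.range N, ((i + k).choose k : R) * u ^ i) - 1 := by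
  induction k with
  | zero =>
    have h := mul_neg_geom_sum u N
    refine ⟨-1, ?_⟩
    simp only [add_zero, Nat.choose_zero_right, Nat.cast_one, one_mul, zero_add, pow_one]
    rw [h]
    ring
  | succ k ih =>
    obtain ⟨c, hc⟩ := ih
    refine ⟨c - (1 - u) ^ (k + 1) * ((N + k).choose (k + 1) : R), ?_⟩
    rw [pow_succ, mul_assoc, one_sub_mul_sum_choose]
    linear_combination hc

/-- Expansion of the powers of a solution of `G = A + z * A * B * G`. -/
lemma pow_dvd_pow_succ_sub_sum {R : Type*} [CommRing R] {G A B z : R}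
    (h : G = A + z * A * B * G) (k N : ℕ) :
    z ^ N ∣ G ^ (k + 1) - ∑ i ∈ Finset.range N,
      ((i + k).choose k : R) * (z ^ i * (A ^ (i + k + 1) * B ^ i)) := by
  obtain ⟨c, hc⟩ := pow_dvd_one_sub_pow_mul_sum_choose (z * A * B) k N
  have h1 : A = G * (1 - z * A * B) := by linear_combination -h
  have h2 : ∑ i ∈ Finset.range N, ((i + k).choose k : R) * (z ^ i * (A ^ (i + k + 1) * B ^ i)) =
      A ^ (k + 1) * ∑ i ∈ Finset.range N, ((i + k).choose k : R) * (z * A * B) ^ i := by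
    rw [Finset.mul_sum]
    exact Finset.sum_congr rfl fun i _ => by ring
  have h3 : A ^ (k + 1) = G ^ (k + 1) * (1 - z * A * B) ^ (k + 1) := by
    rw [← mul_pow, ← h1]
  refine ⟨- (G ^ (k + 1) * ((A * B) ^ N * c)), ?_⟩
  rw [h2, h3]
  linear_combination (- G ^ (k + 1)) * hc

/-! ### Walks across a bridge, and inclusion and exclusion over edge subsets. -/

lemma crossing_notMem_union {V : Type*} [DecidableEq V] {H₁ H₂ : Finset (Sym2 V)} {P : V → Prop}
    (h₁ : ∀ e ∈ H₁, ∀ x ∈ e, P x) (h₂ : ∀ e ∈ H₂, ∀ x ∈ e, ¬ P x)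
    {r v : V} (hr : P r) (hv : ¬ P v) : s(r, v) ∉ H₁ ∪ H₂ := by
  intro h
  rcases Finset.mem_union.1 h with h | h
  · exact hv (h₁ _ h v (Sym2.mem_mk_right r v))
  · exact h₂ _ h r (Sym2.mem_mk_left r v) hr

lemma disjoint_of_separated {V : Type*} {T₁ T₂ : Finset (Sym2 V)} {P : V → Prop}
    (h₁ : ∀ e ∈ T₁, ∀ x ∈ e, P x) (h₂ : ∀ e ∈ T₂, ∀ x ∈ e, ¬ P x) :
    Disjoint T₁ T₂ := by
  rw [Finset.disjoint_left]
  intro e he he'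
  induction e with
  | _ a b => exact h₂ _ he' a (Sym2.mem_mk_left a b) (h₁ _ he a (Sym2.mem_mk_left a b))

section Separated

variable {V : Type*} [Fintype V] [DecidableEq V]

lemma edgeAdj_pow_congr {H H' : Finset (Sym2 V)} {P : V → Prop}
    (hclosed : ∀ a b, P a → s(a, b) ∈ H → P b)
    (hagree : ∀ a b, P a → (s(a, b) ∈ H ↔ s(a, b) ∈ H')) (n : ℕ) {u : V} (hu : P u) (w : V) :
    (edgeAdj H ^ n) u w = (edgeAdj H' ^ n) u w := by
  induction n generalizing u with
  | zero => simp
  | succ n ih =>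
    rw [pow_succ', pow_succ', Matrix.mul_apply, Matrix.mul_apply]
    refine Finset.sum_congr rfl fun x _ => ?_
    simp only [edgeAdj, Matrix.of_apply, ← hagree u x hu]
    split_ifs with h
    · rw [one_mul, one_mul]
      exact ih (hclosed u x hu h)
    · rw [zero_mul, zero_mul]

lemma edgeAdj_pow_eq_zero {H : Finset (Sym2 V)} {P : V → Prop}
    (hclosed : ∀ a b, P a → s(a, b) ∈ H → P b) (n : ℕ) {u w : V} (hu : P u) (hw : ¬ P w) :
    (edgeAdj H ^ n) u w = 0 := by
  induction n generalizing u with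
  | zero =>
    rw [pow_zero, Matrix.one_apply, if_neg]
    rintro rfl
    exact hw hu
  | succ n ih =>
    rw [pow_succ', Matrix.mul_apply]
    refine Finset.sum_eq_zero fun x _ => ?_
    simp only [edgeAdj, Matrix.of_apply]
    split_ifs with h
    · rw [one_mul]
      exact ih (hclosed u x hu h)
    · rw [zero_mul]

variable {H₁ H₂ : Finset (Sym2 V)} {P : V → Prop}

lemma walkGF_union_left (h₁ : ∀ e ∈ H₁, ∀ x ∈ e, P x) (h₂ : ∀ e ∈ H₂, ∀ x ∈ e, ¬ P x)
    {u : V} (hu : P u) (w : V) : walkGF (H₁ ∪ H₂) u w = walkGF H₁ u w := by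
  ext n
  rw [walkGF, walkGF, coeff_mk, coeff_mk]
  refine edgeAdj_pow_congr (P := P) ?_ ?_ n hu w
  · intro a b ha hab
    rcases Finset.mem_union.1 hab with h | h
    · exact h₁ _ h b (Sym2.mem_mk_right a b)
    · exact absurd ha (h₂ _ h a (Sym2.mem_mk_left a b))
  · intro a b ha
    rw [Finset.mem_union, or_iff_left]
    exact fun h => h₂ _ h a (Sym2.mem_mk_left a b) ha

lemma walkGF_union_right (h₁ : ∀ e ∈ H₁, ∀ x ∈ e, P x) (h₂ : ∀ e ∈ H₂, ∀ x ∈ e, ¬ P x)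
    {u : V} (hu : ¬ P u) (w : V) : walkGF (H₁ ∪ H₂) u w = walkGF H₂ u w := by
  rw [Finset.union_comm]
  exact walkGF_union_left (P := fun x => ¬ P x) h₂
    (fun e he x hx => not_not_intro (h₁ e he x hx)) hu w

lemma walkGF_union_eq_zero (h₁ : ∀ e ∈ H₁, ∀ x ∈ e, P x) (h₂ : ∀ e ∈ H₂, ∀ x ∈ e, ¬ P x)
    {u w : V} (hu : P u) (hw : ¬ P w) : walkGF (H₁ ∪ H₂) u w = 0 := by
  ext n
  rw [walkGF, coeff_mk, map_zero]
  refine edgeAdj_pow_eq_zero (P := P) ?_ n hu hw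
  intro a b ha hab
  rcases Finset.mem_union.1 hab with h | h
  · exact h₁ _ h b (Sym2.mem_mk_right a b)
  · exact absurd ha (h₂ _ h a (Sym2.mem_mk_left a b))

lemma walkGF_crossing (h₁ : ∀ e ∈ H₁, ∀ x ∈ e, P x) (h₂ : ∀ e ∈ H₂, ∀ x ∈ e, ¬ P x)
    {r v : V} (hr : P r) (hv : ¬ P v) :
    walkGF (insert s(r, v) (H₁ ∪ H₂)) v r =
      PowerSeries.X * walkGF H₂ v v * walkGF (insert s(r, v) (H₁ ∪ H₂)) r r := by
  have hne : r ≠ v := by rintro rfl; exact hv hr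
  have h0 : walkGF (H₁ ∪ H₂) v r = 0 := by
    rw [Finset.union_comm]
    exact walkGF_union_eq_zero (P := fun x => ¬ P x) h₂
      (fun e he x hx => not_not_intro (h₁ e he x hx)) hv (not_not_intro hr)
  have h := walkGF_insert hne (crossing_notMem_union h₁ h₂ hr hv) v r
  rw [h0, walkGF_union_right h₁ h₂ hv] at h
  linear_combination h

lemma walkGF_closed (h₁ : ∀ e ∈ H₁, ∀ x ∈ e, P x) (h₂ : ∀ e ∈ H₂, ∀ x ∈ e, ¬ P x)
    {r v : V} (hr : P r) (hv : ¬ P v) :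
    walkGF (insert s(r, v) (H₁ ∪ H₂)) r r = walkGF H₁ r r +
      PowerSeries.X ^ 2 * walkGF H₁ r r * walkGF H₂ v v * walkGF (insert s(r, v) (H₁ ∪ H₂)) r r := by
  have hne : r ≠ v := by rintro rfl; exact hv hr
  have h := walkGF_insert hne (crossing_notMem_union h₁ h₂ hr hv) r r
  rw [walkGF_union_eq_zero h₁ h₂ hr hv, walkGF_union_left h₁ h₂ hr,
    walkGF_crossing h₁ h₂ hr hv] at h
  linear_combination h

/-- The generating function of the `j`-tuples of closed walks at `r` whose set of edges is `T`,
by inclusion and exclusion. -/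
noncomputable def coverGF (T : Finset (Sym2 V)) (r : V) (j : ℕ) : PowerSeries ℚ :=
  ∑ H ∈ T.powerset, (-1) ^ (T.card + H.card) * walkGF H r r ^ j

/-- The part of `coverGF` in which the first step of the last walk goes from `r` to `v`. -/
noncomputable def coverStepGF (T : Finset (Sym2 V)) (r v : V) (k : ℕ) : PowerSeries ℚ :=
  ∑ H ∈ T.powerset, if s(r, v) ∈ H then
    (-1) ^ (T.card + H.card) * (walkGF H r r ^ k * (PowerSeries.X * walkGF H v r)) else 0

lemma coverGF_succ (T : Finset (Sym2 V)) (r : V) (k : ℕ) :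
    coverGF T r (k + 1) = coverGF T r k +
      ∑ v with s(r, v) ∈ T, coverStepGF T r v k := by
  have h : ∑ v with s(r, v) ∈ T, coverStepGF T r v k = ∑ v, coverStepGF T r v k := by
    rw [Finset.sum_filter]
    refine Finset.sum_congr rfl fun v _ => ?_
    split_ifs with h
    · rfl
    · refine (Finset.sum_eq_zero fun H hH => if_neg fun hv => h ?_).symm
      exact Finset.mem_powerset.1 hH hv
  rw [h]
  simp only [coverGF, coverStepGF]
  rw [Finset.sum_comm, ← Finset.sum_add_distrib]
  refine Finset.sum_congr rfl fun H _ => ?_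
  rw [pow_succ]
  nth_rewrite 2 [walkGF_first_step]
  rw [if_pos rfl, mul_add, mul_one, mul_add, Finset.mul_sum, Finset.mul_sum]
  refine congrArg (_ + ·) (Finset.sum_congr rfl fun v _ => ?_)
  split_ifs
  · rfl
  · rw [mul_zero, mul_zero]

lemma sum_powerset_union {α M : Type*} [DecidableEq α] [AddCommMonoid M] {A B : Finset α}
    (h : Disjoint A B) (f : Finset α → M) :
    ∑ s ∈ (A ∪ B).powerset, f s = ∑ a ∈ A.powerset, ∑ b ∈ B.powerset, f (a ∪ b) := by
  rw [← Finset.sum_product']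
  refine Finset.sum_bij' (fun s _ => (s ∩ A, s ∩ B)) (fun p _ => p.1 ∪ p.2) ?_ ?_ ?_ ?_ ?_
  · intro s _
    simp
  · rintro ⟨a, b⟩ hp
    simp only [Finset.mem_product, Finset.mem_powerset] at hp ⊢
    exact Finset.union_subset_union hp.1 hp.2
  · intro s hs
    rw [Finset.mem_powerset] at hs
    simp only
    rw [← Finset.inter_union_distrib_left, Finset.inter_eq_left.2 hs]
  · rintro ⟨a, b⟩ hp
    simp only [Finset.mem_product, Finset.mem_powerset] at hp
    rw [Finset.disjoint_left] at h
    ext x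
    · simp only [Finset.mem_inter, Finset.mem_union]
      exact ⟨fun hx => hx.1.resolve_right fun hb => h hx.2 (hp.2 hb), fun hx => ⟨.inl hx, hp.1 hx⟩⟩
    · simp only [Finset.mem_inter, Finset.mem_union]
      exact ⟨fun hx => hx.1.resolve_left fun ha => h (hp.1 ha) hx.2, fun hx => ⟨.inr hx, hp.2 hx⟩⟩
  · intro s hs
    rw [Finset.mem_powerset] at hs
    simp only
    rw [← Finset.inter_union_distrib_left, Finset.inter_eq_left.2 hs]

variable {T₁ T₂ : Finset (Sym2 V)}

/-- The subsets that count are `insert s(r, v) (H₁ ∪ H₂)`, and their signs factor. With `A`, `B` and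
`G` the closed-walk series of `H₁` at `r`, of `H₂` at `v` and of the joined set at `r`, the summand
is `G ^ (k + 1) * (z² * B)`. Expanding the power separates the two sides, so each sums to a
`coverGF` of its own. -/
lemma coverStepGF_insert_union (h₁ : ∀ e ∈ T₁, ∀ x ∈ e, P x) (h₂ : ∀ e ∈ T₂, ∀ x ∈ e, ¬ P x)
    {r v : V} (hr : P r) (hv : ¬ P v) (k N : ℕ) :
    PowerSeries.X ^ N ∣ coverStepGF (insert s(r, v) (T₁ ∪ T₂)) r v k -
      ∑ i ∈ Finset.range N, ((i + k).choose k : PowerSeries ℚ) *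
        ((PowerSeries.X ^ 2) ^ (i + 1) * (coverGF T₁ r (i + k + 1) * coverGF T₂ v (i + 1))) := by
  have hnot := crossing_notMem_union h₁ h₂ hr hv
  have hdisj := disjoint_of_separated h₁ h₂
  have e1 : coverStepGF (insert s(r, v) (T₁ ∪ T₂)) r v k =
      ∑ H₁ ∈ T₁.powerset, ∑ H₂ ∈ T₂.powerset,
        (-1) ^ (T₁.card + H₁.card) * (-1) ^ (T₂.card + H₂.card) *
          (walkGF (insert s(r, v) (H₁ ∪ H₂)) r r ^ (k + 1) *
            (PowerSeries.X ^ 2 * walkGF H₂ v v)) := by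
    rw [coverStepGF, Finset.sum_powerset_insert hnot, Finset.sum_eq_zero, zero_add,
      sum_powerset_union hdisj]
    · refine Finset.sum_congr rfl fun H₁ hH₁ => Finset.sum_congr rfl fun H₂ hH₂ => ?_
      rw [Finset.mem_powerset] at hH₁ hH₂
      have g₁ : ∀ e ∈ H₁, ∀ x ∈ e, P x := fun e he => h₁ e (hH₁ he)
      have g₂ : ∀ e ∈ H₂, ∀ x ∈ e, ¬ P x := fun e he => h₂ e (hH₂ he)
      rw [if_pos (Finset.mem_insert_self _ _), walkGF_crossing g₁ g₂ hr hv,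
        Finset.card_insert_of_notMem hnot, Finset.card_union_of_disjoint hdisj,
        Finset.card_insert_of_notMem (crossing_notMem_union g₁ g₂ hr hv),
        Finset.card_union_of_disjoint (disjoint_of_separated g₁ g₂)]
      ring
    · intro H hH
      exact if_neg fun h => hnot (Finset.mem_powerset.1 hH h)
  have e2 : ∑ i ∈ Finset.range N, ((i + k).choose k : PowerSeries ℚ) *
        ((PowerSeries.X ^ 2) ^ (i + 1) * (coverGF T₁ r (i + k + 1) * coverGF T₂ v (i + 1))) =
      ∑ H₁ ∈ T₁.powerset, ∑ H₂ ∈ T₂.powerset,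
        (-1) ^ (T₁.card + H₁.card) * (-1) ^ (T₂.card + H₂.card) *
          ((∑ i ∈ Finset.range N, ((i + k).choose k : PowerSeries ℚ) * ((PowerSeries.X ^ 2) ^ i *
            (walkGF H₁ r r ^ (i + k + 1) * walkGF H₂ v v ^ i))) *
            (PowerSeries.X ^ 2 * walkGF H₂ v v)) := by
    have h : ∀ i, coverGF T₁ r (i + k + 1) * coverGF T₂ v (i + 1) =
        ∑ H₁ ∈ T₁.powerset, ∑ H₂ ∈ T₂.powerset,
          (-1) ^ (T₁.card + H₁.card) * walkGF H₁ r r ^ (i + k + 1) *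
            ((-1) ^ (T₂.card + H₂.card) * walkGF H₂ v v ^ (i + 1)) :=
      fun i => Finset.sum_mul_sum _ _ _ _
    simp only [h, Finset.mul_sum, Finset.sum_mul]
    rw [Finset.sum_comm]
    refine Finset.sum_congr rfl fun H₁ _ => ?_
    rw [Finset.sum_comm]
    refine Finset.sum_congr rfl fun H₂ _ => Finset.sum_congr rfl fun i _ => ?_
    ring
  rw [e1, e2, ← Finset.sum_sub_distrib]
  refine Finset.dvd_sum fun H₁ hH₁ => ?_
  rw [← Finset.sum_sub_distrib]
  refine Finset.dvd_sum fun H₂ hH₂ => ?_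
  rw [Finset.mem_powerset] at hH₁ hH₂
  rw [← mul_sub, ← sub_mul]
  -- The expansion is in powers of `X ^ 2`, so its error is divisible by `(X ^ 2) ^ N`, more than is
  -- needed.
  refine Dvd.dvd.mul_left
    (Dvd.dvd.mul_right (Dvd.dvd.trans (b := (PowerSeries.X ^ 2) ^ N) ?_ ?_) _) _
  · rw [← pow_mul]
    exact pow_dvd_pow _ (by omega)
  · exact pow_dvd_pow_succ_sub_sum (walkGF_closed (fun e he => h₁ e (hH₁ he))
      (fun e he => h₂ e (hH₂ he)) hr hv) k N

lemma coverGF_zero (T : Finset (Sym2 V)) (r : V) :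
    coverGF T r 0 = if T = ∅ then 1 else 0 := by
  have h : coverGF T r 0 = (-1) ^ T.card * ∑ H ∈ T.powerset, (-1) ^ H.card := by
    rw [coverGF, Finset.mul_sum]
    exact Finset.sum_congr rfl fun H _ => by ring
  have h2 : (∑ H ∈ T.powerset, (-1) ^ H.card : PowerSeries ℚ) =
      ((∑ H ∈ T.powerset, (-1) ^ H.card : ℤ) : PowerSeries ℚ) := by
    push_cast; rfl
  rw [h, h2, Finset.sum_powerset_neg_one_pow_card]
  split_ifs with hT
  · subst hT; simp
  · simp

end Separated

/-! ### Trees as edge sets, split and joined at an edge. -/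

section Trees

variable {V : Type*}

/-- `b` can be reached from `a` along edges in `T`. -/
def EdgeReach (T : Finset (Sym2 V)) : V → V → Prop :=
  Relation.ReflTransGen fun a b => s(a, b) ∈ T

lemma EdgeReach.mono {T T' : Finset (Sym2 V)} (hT : T ⊆ T') {a b : V} (h : EdgeReach T a b) :
    EdgeReach T' a b := by
  induction h with
  | refl => exact Relation.ReflTransGen.refl
  | tail _ hyz ih => exact ih.tail (hT hyz)

lemma EdgeReach.trans {T : Finset (Sym2 V)} {a b c : V} (h : EdgeReach T a b)
    (h' : EdgeReach T b c) : EdgeReach T a c :=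
  Relation.ReflTransGen.trans h h'

lemma EdgeReach.of_mem {T : Finset (Sym2 V)} {a b : V} (h : s(a, b) ∈ T) : EdgeReach T a b :=
  Relation.ReflTransGen.single h

lemma EdgeReach.symm {T : Finset (Sym2 V)} {a b : V} (h : EdgeReach T a b) : EdgeReach T b a := by
  induction h with
  | refl => exact Relation.ReflTransGen.refl
  | tail _ hyz ih => exact EdgeReach.trans (EdgeReach.of_mem (by rwa [Sym2.eq_swap])) ih

lemma EdgeReach.invariant {T : Finset (Sym2 V)} {P : V → Prop}
    (h : ∀ a b, P a → s(a, b) ∈ T → P b) {a b : V} (hab : EdgeReach T a b) (ha : P a) : P b := by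
  induction hab with
  | refl => exact ha
  | tail _ hyz ih => exact h _ _ ih hyz

variable [DecidableEq V]

/-- `T` is the edge set of a tree with vertex set `S`. -/
structure IsTreeOn (S : Finset V) (T : Finset (Sym2 V)) : Prop where
  mem_of_mem : ∀ e ∈ T, ∀ x ∈ e, x ∈ S
  reach : ∀ u ∈ S, ∀ w ∈ S, EdgeReach T u w
  bridge : ∀ a b, s(a, b) ∈ T → ¬ EdgeReach (T.erase s(a, b)) a b

/-- The region `P` can be left and re-entered only through `r`, so excursions outside may be
deleted. The induction therefore tracks reaching `r` whenever the current vertex lies outside `P`.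
-/
lemma EdgeReach.erase_of_insert_union {T₁ T₂ : Finset (Sym2 V)} {P : V → Prop}
    (h₁ : ∀ e ∈ T₁, ∀ x ∈ e, P x) (h₂ : ∀ e ∈ T₂, ∀ x ∈ e, ¬ P x) {r v : V} (hr : P r)
    (hv : ¬ P v) {e : Sym2 V} {a b : V} (ha : P a) (hb : P b)
    (h : EdgeReach ((insert s(r, v) (T₁ ∪ T₂)).erase e) a b) : EdgeReach (T₁.erase e) a b := by
  have key : ∀ x, EdgeReach ((insert s(r, v) (T₁ ∪ T₂)).erase e) a x →
      (P x → EdgeReach (T₁.erase e) a x) ∧ (¬ P x → EdgeReach (T₁.erase e) a r) := by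
    intro x hx
    induction hx with
    | refl => exact ⟨fun _ => Relation.ReflTransGen.refl, fun h => absurd ha h⟩
    | @tail y z _ hyz ih =>
      rw [Finset.mem_erase, Finset.mem_insert, Finset.mem_union] at hyz
      obtain ⟨hne, heq | hmem | hmem⟩ := hyz
      · rcases Sym2.eq_iff.1 heq with ⟨rfl, rfl⟩ | ⟨rfl, rfl⟩
        · exact ⟨fun h => absurd h hv, fun _ => ih.1 hr⟩
        · exact ⟨fun _ => ih.2 hv, fun h => absurd hr h⟩
      · have hy := h₁ _ hmem y (Sym2.mem_mk_left y z)
        have hz := h₁ _ hmem z (Sym2.mem_mk_right y z)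
        exact ⟨fun _ => (ih.1 hy).tail (Finset.mem_erase.2 ⟨hne, hmem⟩), fun h => absurd hz h⟩
      · have hy := h₂ _ hmem y (Sym2.mem_mk_left y z)
        have hz := h₂ _ hmem z (Sym2.mem_mk_right y z)
        exact ⟨fun h => absurd h hz, fun _ => ih.2 hy⟩
  exact (key b h).1 hb

lemma not_edgeReach_union {T₁ T₂ : Finset (Sym2 V)} {P : V → Prop}
    (h₁ : ∀ e ∈ T₁, ∀ x ∈ e, P x) (h₂ : ∀ e ∈ T₂, ∀ x ∈ e, ¬ P x) {r v : V} (hr : P r)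
    (hv : ¬ P v) : ¬ EdgeReach (T₁ ∪ T₂) r v := by
  intro h
  refine hv (EdgeReach.invariant (P := P) (fun a b ha hab => ?_) h hr)
  rcases Finset.mem_union.1 hab with hab | hab
  · exact h₁ _ hab b (Sym2.mem_mk_right a b)
  · exact absurd ha (h₂ _ hab a (Sym2.mem_mk_left a b))

lemma IsTreeOn.join {S₁ S₂ : Finset V} {T₁ T₂ : Finset (Sym2 V)} (t₁ : IsTreeOn S₁ T₁)
    (t₂ : IsTreeOn S₂ T₂) (hS : Disjoint S₁ S₂) {r v : V} (hr : r ∈ S₁) (hv : v ∈ S₂) :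
    IsTreeOn (S₁ ∪ S₂) (insert s(r, v) (T₁ ∪ T₂)) := by
  rw [Finset.disjoint_left] at hS
  have h₁ : ∀ e ∈ T₁, ∀ x ∈ e, x ∈ S₁ := t₁.mem_of_mem
  have h₂ : ∀ e ∈ T₂, ∀ x ∈ e, ¬ x ∈ S₁ := fun e he x hx h => hS h (t₂.mem_of_mem e he x hx)
  have hv₁ : v ∉ S₁ := fun h => hS h hv
  have hr₂ : r ∉ S₂ := hS hr
  have hle₁ : T₁ ⊆ insert s(r, v) (T₁ ∪ T₂) :=
    Finset.subset_union_left.trans (Finset.subset_insert _ _)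
  have hle₂ : T₂ ⊆ insert s(r, v) (T₁ ∪ T₂) :=
    Finset.subset_union_right.trans (Finset.subset_insert _ _)
  refine ⟨?_, ?_, ?_⟩
  · intro e he x hx
    rw [Finset.mem_insert, Finset.mem_union] at he
    rw [Finset.mem_union]
    rcases he with rfl | he | he
    · rcases Sym2.mem_iff.1 hx with rfl | rfl
      · exact .inl hr
      · exact .inr hv
    · exact .inl (h₁ e he x hx)
    · exact .inr (t₂.mem_of_mem e he x hx)
  · have hreach : ∀ x ∈ S₁ ∪ S₂, EdgeReach (insert s(r, v) (T₁ ∪ T₂)) r x := by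
      intro x hx
      rcases Finset.mem_union.1 hx with hx | hx
      · exact (t₁.reach r hr x hx).mono hle₁
      · exact (EdgeReach.of_mem (Finset.mem_insert_self _ _)).trans
          ((t₂.reach v hv x hx).mono hle₂)
    exact fun u hu w hw => (hreach u hu).symm.trans (hreach w hw)
  · intro a b hab h
    rw [Finset.mem_insert, Finset.mem_union] at hab
    rcases hab with hab | hab | hab
    · rw [hab, Finset.erase_insert (crossing_notMem_union h₁ h₂ hr hv₁)] at h
      rcases Sym2.eq_iff.1 hab with ⟨rfl, rfl⟩ | ⟨rfl, rfl⟩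
      · exact not_edgeReach_union h₁ h₂ hr hv₁ h
      · exact not_edgeReach_union h₁ h₂ hr hv₁ h.symm
    · exact t₁.bridge a b hab (EdgeReach.erase_of_insert_union h₁ h₂ hr hv₁
        (h₁ _ hab a (Sym2.mem_mk_left a b)) (h₁ _ hab b (Sym2.mem_mk_right a b)) h)
    · rw [Sym2.eq_swap (a := r), Finset.union_comm] at h
      exact t₂.bridge a b hab (EdgeReach.erase_of_insert_union (P := fun x => x ∈ S₂)
        t₂.mem_of_mem (fun e he x hx => hS (h₁ e he x hx)) hv hr₂
        (t₂.mem_of_mem _ hab a (Sym2.mem_mk_left a b))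
        (t₂.mem_of_mem _ hab b (Sym2.mem_mk_right a b)) h)

lemma IsTreeOn.exists_split {S : Finset V} {T : Finset (Sym2 V)} (t : IsTreeOn S T) {r v : V}
    (hrv : s(r, v) ∈ T) :
    ∃ S₂ ⊆ S.erase r, v ∈ S₂ ∧ ∃ T₁ T₂, IsTreeOn (S \ S₂) T₁ ∧ IsTreeOn S₂ T₂ ∧
      insert s(r, v) (T₁ ∪ T₂) = T := by
  classical
  have hr : r ∈ S := t.mem_of_mem _ hrv r (Sym2.mem_mk_left r v)
  have hv : v ∈ S := t.mem_of_mem _ hrv v (Sym2.mem_mk_right r v)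
  set T₀ := T.erase s(r, v) with hT₀
  have hT₀T : T₀ ⊆ T := Finset.erase_subset _ _
  -- The far side consists of the vertices cut off from `r` when the edge is erased; it contains `v`
  -- because the edge is a bridge.
  set S₂ := S.filter fun x => ¬ EdgeReach T₀ r x with hS₂
  have mem₂ : ∀ x, x ∈ S₂ ↔ x ∈ S ∧ ¬ EdgeReach T₀ r x := fun x => Finset.mem_filter
  have mem₁ : ∀ x, x ∈ S \ S₂ ↔ x ∈ S ∧ EdgeReach T₀ r x := by
    intro x
    rw [Finset.mem_sdiff, mem₂]
    tauto
  have hv₂ : v ∈ S₂ := (mem₂ v).2 ⟨hv, t.bridge r v hrv⟩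
  set T₁ := T₀.filter fun e => ∀ x ∈ e, x ∈ S \ S₂ with hT₁
  set T₂ := T₀.filter fun e => ∀ x ∈ e, x ∈ S₂ with hT₂
  have e₁ : ∀ a b, EdgeReach T₀ r a → s(a, b) ∈ T₀ → s(a, b) ∈ T₁ := by
    intro a b ha hab
    refine Finset.mem_filter.2 ⟨hab, fun x hx => (mem₁ x).2 ⟨t.mem_of_mem _ (hT₀T hab) x hx, ?_⟩⟩
    rcases Sym2.mem_iff.1 hx with rfl | rfl
    · exact ha
    · exact ha.trans (EdgeReach.of_mem hab)
  have e₂ : ∀ a b, ¬ EdgeReach T₀ r a → s(a, b) ∈ T₀ → s(a, b) ∈ T₂ := by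
    intro a b ha hab
    refine Finset.mem_filter.2 ⟨hab, fun x hx => (mem₂ x).2 ⟨t.mem_of_mem _ (hT₀T hab) x hx, ?_⟩⟩
    rcases Sym2.mem_iff.1 hx with rfl | rfl
    · exact ha
    · exact fun h => ha (h.trans (EdgeReach.of_mem hab).symm)
  have reach₁ : ∀ x, EdgeReach T₀ r x → EdgeReach T₁ r x := by
    intro x hx
    induction hx with
    | refl => exact Relation.ReflTransGen.refl
    | tail h hyz ih => exact ih.tail (e₁ _ _ h hyz)
  have reach₂ : ∀ x, EdgeReach T r x → EdgeReach T₀ r x ∨ EdgeReach T₂ v x := by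
    intro x hx
    induction hx with
    | refl => exact .inl Relation.ReflTransGen.refl
    | @tail y z _ hyz ih =>
      by_cases heq : s(y, z) = s(r, v)
      · rcases Sym2.eq_iff.1 heq with ⟨-, rfl⟩ | ⟨-, rfl⟩
        · exact .inr Relation.ReflTransGen.refl
        · exact .inl Relation.ReflTransGen.refl
      · have hyz' : s(y, z) ∈ T₀ := Finset.mem_erase.2 ⟨heq, hyz⟩
        by_cases hy : EdgeReach T₀ r y
        · exact .inl (hy.tail hyz')
        · exact .inr ((ih.resolve_left hy).tail (e₂ y z hy hyz'))
  refine ⟨S₂, ?_, hv₂, T₁, T₂, ⟨?_, ?_, ?_⟩, ⟨?_, ?_, ?_⟩, ?_⟩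
  · intro x hx
    refine Finset.mem_erase.2 ⟨?_, ((mem₂ x).1 hx).1⟩
    rintro rfl
    exact ((mem₂ x).1 hx).2 Relation.ReflTransGen.refl
  · exact fun e he => (Finset.mem_filter.1 he).2
  · exact fun u hu w hw => (reach₁ u ((mem₁ u).1 hu).2).symm.trans (reach₁ w ((mem₁ w).1 hw).2)
  · intro a b hab h
    have hsub : T₁ ⊆ T := (Finset.filter_subset _ _).trans hT₀T
    exact t.bridge a b (hsub hab) (h.mono (Finset.erase_subset_erase _ hsub))
  · exact fun e he => (Finset.mem_filter.1 he).2
  · have : ∀ x ∈ S₂, EdgeReach T₂ v x := fun x hx =>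
      (reach₂ x (t.reach r hr x ((mem₂ x).1 hx).1)).resolve_left ((mem₂ x).1 hx).2
    exact fun u hu w hw => (this u hu).symm.trans (this w hw)
  · intro a b hab h
    have hsub : T₂ ⊆ T := (Finset.filter_subset _ _).trans hT₀T
    exact t.bridge a b (hsub hab) (h.mono (Finset.erase_subset_erase _ hsub))
  · ext e
    induction e with
    | _ a b =>
    rw [Finset.mem_insert, Finset.mem_union]
    constructor
    · rintro (h | h | h)
      · rw [h]; exact hrv
      · exact hT₀T (Finset.mem_filter.1 h).1
      · exact hT₀T (Finset.mem_filter.1 h).1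
    · intro h
      by_cases heq : s(a, b) = s(r, v)
      · exact .inl heq
      · have h0 : s(a, b) ∈ T₀ := Finset.mem_erase.2 ⟨heq, h⟩
        by_cases ha : EdgeReach T₀ r a
        · exact .inr (.inl (e₁ a b ha h0))
        · exact .inr (.inr (e₂ a b ha h0))

lemma mem_iff_of_split {S S₂ : Finset V} {T₁ T₂ : Finset (Sym2 V)} {r : V} (hr : r ∈ S)
    (hS₂ : S₂ ⊆ S.erase r) (t₁ : IsTreeOn (S \ S₂) T₁) (t₂ : IsTreeOn S₂ T₂) (x : V) :
    x ∈ S₂ ↔ x ∈ S ∧ ¬ EdgeReach (T₁ ∪ T₂) r x := by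
  have hr₁ : r ∈ S \ S₂ :=
    Finset.mem_sdiff.2 ⟨hr, fun h => (Finset.mem_erase.1 (hS₂ h)).1 rfl⟩
  constructor
  · intro hx
    refine ⟨(Finset.mem_erase.1 (hS₂ hx)).2, ?_⟩
    exact not_edgeReach_union (P := fun x => x ∈ S \ S₂) t₁.mem_of_mem
      (fun e he y hy h => (Finset.mem_sdiff.1 h).2 (t₂.mem_of_mem e he y hy)) hr₁
      (fun h => (Finset.mem_sdiff.1 h).2 hx)
  · rintro ⟨hxS, hx⟩
    by_contra hx₂
    exact hx ((t₁.reach r hr₁ x (Finset.mem_sdiff.2 ⟨hxS, hx₂⟩)).mono Finset.subset_union_left)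

lemma left_eq_filter_of_split {S S₂ : Finset V} {T₁ T₂ : Finset (Sym2 V)}
    (t₁ : IsTreeOn (S \ S₂) T₁) (t₂ : IsTreeOn S₂ T₂) :
    T₁ = {e ∈ T₁ ∪ T₂ | e ∉ T₂} := by
  have := disjoint_of_separated (P := fun x => x ∈ S \ S₂) t₁.mem_of_mem
    (fun e he y hy h => (Finset.mem_sdiff.1 h).2 (t₂.mem_of_mem e he y hy))
  rw [Finset.disjoint_left] at this
  ext e
  rw [Finset.mem_filter, Finset.mem_union]
  exact ⟨fun h => ⟨.inl h, this h⟩, fun h => h.1.resolve_right h.2⟩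

lemma right_subset_of_split {S₂ : Finset V} {T₁ T₂ T₁' T₂' : Finset (Sym2 V)} {S : Finset V}
    (t₂ : IsTreeOn S₂ T₂) (t₁' : IsTreeOn (S \ S₂) T₁') (h : T₁ ∪ T₂ = T₁' ∪ T₂') : T₂ ⊆ T₂' := by
  intro e he
  have h' : e ∈ T₁' ∪ T₂' := h ▸ Finset.mem_union_right _ he
  refine (Finset.mem_union.1 h').resolve_left fun he' => ?_
  induction e with
  | _ a b =>
    exact (Finset.mem_sdiff.1 (t₁'.mem_of_mem _ he' a (Sym2.mem_mk_left a b))).2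
      (t₂.mem_of_mem _ he a (Sym2.mem_mk_left a b))

/-- Erasing the edge recovers `T₁ ∪ T₂`; reachability from `r` then recovers `S₂`, and the vertex
sets separate the two trees. This is the injectivity needed for `sum_treesOn_neighbors`. -/
lemma eq_of_insert_union_eq {S S₂ S₂' : Finset V} {T₁ T₂ T₁' T₂' : Finset (Sym2 V)} {r v : V}
    (hr : r ∈ S) (hS₂ : S₂ ⊆ S.erase r) (hv : v ∈ S₂) (t₁ : IsTreeOn (S \ S₂) T₁)
    (t₂ : IsTreeOn S₂ T₂) (hS₂' : S₂' ⊆ S.erase r) (hv' : v ∈ S₂') (t₁' : IsTreeOn (S \ S₂') T₁')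
    (t₂' : IsTreeOn S₂' T₂')
    (h : insert s(r, v) (T₁ ∪ T₂) = insert s(r, v) (T₁' ∪ T₂')) :
    S₂ = S₂' ∧ T₁ = T₁' ∧ T₂ = T₂' := by
  have hnot : ∀ {S₂ : Finset V} {T₁ T₂ : Finset (Sym2 V)}, S₂ ⊆ S.erase r → v ∈ S₂ →
      IsTreeOn (S \ S₂) T₁ → IsTreeOn S₂ T₂ → s(r, v) ∉ T₁ ∪ T₂ := by
    intro S₂ T₁ T₂ hS₂ hv t₁ t₂
    exact crossing_notMem_union (P := fun x => x ∈ S \ S₂) t₁.mem_of_mem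
      (fun e he y hy h => (Finset.mem_sdiff.1 h).2 (t₂.mem_of_mem e he y hy))
      (Finset.mem_sdiff.2 ⟨hr, fun h => (Finset.mem_erase.1 (hS₂ h)).1 rfl⟩)
      (fun h => (Finset.mem_sdiff.1 h).2 hv)
  have hu : T₁ ∪ T₂ = T₁' ∪ T₂' := by
    rw [← Finset.erase_insert (hnot hS₂ hv t₁ t₂), h, Finset.erase_insert (hnot hS₂' hv' t₁' t₂')]
  have hS : S₂ = S₂' := by
    ext x
    rw [mem_iff_of_split hr hS₂ t₁ t₂, mem_iff_of_split hr hS₂' t₁' t₂', hu]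
  subst hS
  have hT : T₂ = T₂' := Finset.Subset.antisymm (right_subset_of_split t₂ t₁' hu)
    (right_subset_of_split t₂' t₁ hu.symm)
  refine ⟨rfl, ?_, hT⟩
  rw [left_eq_filter_of_split t₁ t₂, left_eq_filter_of_split t₁' t₂', hu, hT]

variable [Fintype V]

open Classical in
/-- The edge sets of the trees with vertex set `S`. -/
noncomputable def treesOn (S : Finset V) : Finset (Finset (Sym2 V)) :=
  Finset.univ.filter (IsTreeOn S)

lemma mem_treesOn {S : Finset V} {T : Finset (Sym2 V)} : T ∈ treesOn S ↔ IsTreeOn S T := by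
  simp [treesOn]

lemma sum_treesOn_neighbors {M : Type*} [AddCommMonoid M] {S : Finset V} {r : V} (hr : r ∈ S)
    (F : Finset (Sym2 V) → V → M) :
    ∑ T ∈ treesOn S, ∑ v with s(r, v) ∈ T, F T v =
      ∑ S₂ ∈ (S.erase r).powerset, ∑ v ∈ S₂, ∑ T₁ ∈ treesOn (S \ S₂), ∑ T₂ ∈ treesOn S₂,
        F (insert s(r, v) (T₁ ∪ T₂)) v := by
  have h : ∀ S₂ : Finset V, ∑ v ∈ S₂, ∑ T₁ ∈ treesOn (S \ S₂), ∑ T₂ ∈ treesOn S₂,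
        F (insert s(r, v) (T₁ ∪ T₂)) v =
      ∑ q ∈ S₂ ×ˢ (treesOn (S \ S₂) ×ˢ treesOn S₂),
        F (insert s(r, q.1) (q.2.1 ∪ q.2.2)) q.1 := by
    intro S₂
    simp only [Finset.sum_product]
  simp only [h]
  rw [Finset.sum_sigma', Finset.sum_sigma']
  symm
  refine Finset.sum_nbij
    (fun q => (⟨insert s(r, q.2.1) (q.2.2.1 ∪ q.2.2.2), q.2.1⟩ : Σ _ : Finset (Sym2 V), V))
    ?_ ?_ ?_ ?_
  · rintro ⟨S₂, v, T₁, T₂⟩ hq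
    simp only [Finset.mem_sigma, Finset.mem_product, Finset.mem_powerset, mem_treesOn] at hq
    obtain ⟨hS₂, hv, t₁, t₂⟩ := hq
    simp only [Finset.mem_sigma, mem_treesOn, Finset.mem_filter, Finset.mem_univ, true_and]
    refine ⟨?_, Finset.mem_insert_self _ _⟩
    have := t₁.join t₂ Finset.sdiff_disjoint (Finset.mem_sdiff.2
      ⟨hr, fun h => (Finset.mem_erase.1 (hS₂ h)).1 rfl⟩) hv
    rwa [Finset.sdiff_union_of_subset (hS₂.trans (Finset.erase_subset _ _))] at this
  · rintro ⟨S₂, v, T₁, T₂⟩ hq ⟨S₂', v', T₁', T₂'⟩ hq' heq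
    simp only [Finset.coe_sigma, Set.mem_sigma_iff, Finset.mem_coe, Finset.mem_product,
      Finset.mem_powerset, mem_treesOn] at hq hq'
    simp only [Sigma.mk.injEq, heq_eq_eq] at heq
    obtain ⟨hT, rfl⟩ := heq
    obtain ⟨hS₂, hv, t₁, t₂⟩ := hq
    obtain ⟨hS₂', hv', t₁', t₂'⟩ := hq'
    obtain ⟨rfl, rfl, rfl⟩ := eq_of_insert_union_eq hr hS₂ hv t₁ t₂ hS₂' hv' t₁' t₂' hT
    rfl
  · rintro ⟨T, v⟩ hq
    simp only [Finset.coe_sigma, Set.mem_sigma_iff, Finset.mem_coe, mem_treesOn,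
      Finset.mem_filter, Finset.mem_univ, true_and] at hq
    obtain ⟨S₂, hS₂, hv, T₁, T₂, t₁, t₂, hT⟩ := hq.1.exists_split hq.2
    refine ⟨⟨S₂, v, T₁, T₂⟩, ?_, ?_⟩
    · simp only [Finset.coe_sigma, Set.mem_sigma_iff, Finset.mem_coe, Finset.mem_product,
        Finset.mem_powerset, mem_treesOn]
      exact ⟨hS₂, hv, t₁, t₂⟩
    · simp only [hT]
  · intros; rfl

end Trees

/-! ### Summation over all trees and comparison of the recursions. -/

lemma eq_of_forall_X_pow_dvd_sub {R : Type*} [CommRing R] {f g : PowerSeries R}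
    (h : ∀ N, PowerSeries.X ^ N ∣ f - g) : f = g := by
  ext n
  rw [← sub_eq_zero, ← map_sub]
  exact PowerSeries.X_pow_dvd_iff.1 (h (n + 1)) n (by omega)

/-- Label bookkeeping: the choice of the far vertex set, the `b + 1` choices of `v` in it and the
two factorials multiply to `(m + 1)!`, independently of `b`. -/
lemma sum_powerset_factorial_mul {V : Type*} {m : ℕ} {A : Finset V} (hA : A.card = m + 1)
    (h : ℕ → ℕ → PowerSeries ℚ) (f : Finset V → PowerSeries ℚ)
    (hf : ∀ B ⊆ A, B.card = 0 → f B = 0)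
    (hf' : ∀ B ⊆ A, ∀ b, B.card = b + 1 →
      f B = (((b + 1) * b.factorial * (m - b).factorial : ℕ) : PowerSeries ℚ) * h (m - b) b) :
    ∑ B ∈ A.powerset, f B =
      ((m + 1).factorial : PowerSeries ℚ) * ∑ p ∈ antidiagonal m, h p.1 p.2 := by
  let F : ℕ → PowerSeries ℚ := fun c => if c = 0 then 0 else
    ((c * (c - 1).factorial * (m - (c - 1)).factorial : ℕ) : PowerSeries ℚ) *
      h (m - (c - 1)) (c - 1)
  have h1 : ∑ B ∈ A.powerset, f B = ∑ B ∈ A.powerset, F B.card := by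
    refine Finset.sum_congr rfl fun B hB => ?_
    rw [Finset.mem_powerset] at hB
    rcases hc : B.card with _ | b
    · rw [hf B hB hc]; rfl
    · rw [hf' B hB b hc]; rfl
  have h2 : ∀ b ∈ Finset.range (m + 1), (m + 1).choose (b + 1) • F (b + 1) =
      ((m + 1).factorial : PowerSeries ℚ) * h (m - b) b := by
    intro b hb
    rw [Finset.mem_range] at hb
    have hn : (m + 1).choose (b + 1) * ((b + 1) * b.factorial * (m - b).factorial) =
        (m + 1).factorial := by
      rw [← Nat.choose_mul_factorial_mul_factorial (show b + 1 ≤ m + 1 by omega),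
        Nat.factorial_succ b, Nat.add_sub_add_right]
      ring
    rw [← hn, nsmul_eq_mul, Nat.cast_mul ((m + 1).choose (b + 1)), mul_assoc]
    rfl
  rw [h1, Finset.sum_powerset_apply_card, hA, Finset.sum_range_succ', Finset.sum_congr rfl h2,
    ← Finset.mul_sum, ← Finset.Nat.sum_antidiagonal_swap,
    Finset.Nat.sum_antidiagonal_eq_sum_range_succ_mk]
  simp [F]

section Total

variable {V : Type*} [DecidableEq V]

lemma isTreeOn_empty_iff {S : Finset V} {r : V} (hr : r ∈ S) :
    IsTreeOn S (∅ : Finset (Sym2 V)) ↔ S = {r} := by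
  constructor
  · intro h
    refine Finset.eq_singleton_iff_unique_mem.2 ⟨hr, fun x hx => ?_⟩
    exact EdgeReach.invariant (P := fun x => x = r) (fun a b _ hab => by simp at hab)
      (h.reach r hr x hx) rfl
  · rintro rfl
    refine ⟨by simp, ?_, by simp⟩
    intro u hu w hw
    rw [Finset.mem_singleton] at hu hw
    subst hu hw
    exact Relation.ReflTransGen.refl

variable [Fintype V]

/-- The generating function of the `j`-tuples of closed walks at `r` whose edges form a tree
with vertex set `S`. -/
noncomputable def totalGF (S : Finset V) (r : V) (j : ℕ) : PowerSeries ℚ :=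
  ∑ T ∈ treesOn S, coverGF T r j

lemma totalGF_zero {S : Finset V} {r : V} (hr : r ∈ S) :
    totalGF S r 0 = if S = {r} then 1 else 0 := by
  simp only [totalGF, coverGF_zero, Finset.sum_ite_eq', mem_treesOn, isTreeOn_empty_iff hr]

lemma totalGF_succ {S : Finset V} {r : V} (hr : r ∈ S) (k N : ℕ) :
    PowerSeries.X ^ N ∣ totalGF S r (k + 1) - (totalGF S r k +
      ∑ S₂ ∈ (S.erase r).powerset, ∑ v ∈ S₂, ∑ i ∈ Finset.range N,
        ((i + k).choose k : PowerSeries ℚ) * ((PowerSeries.X ^ 2) ^ (i + 1) *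
          (totalGF (S \ S₂) r (i + k + 1) * totalGF S₂ v (i + 1)))) := by
  have h1 : totalGF S r (k + 1) = totalGF S r k +
      ∑ T ∈ treesOn S, ∑ v with s(r, v) ∈ T, coverStepGF T r v k := by
    simp only [totalGF, coverGF_succ, Finset.sum_add_distrib]
  have h2 : ∀ (S₂ : Finset V) (v : V), ∑ i ∈ Finset.range N,
        ((i + k).choose k : PowerSeries ℚ) * ((PowerSeries.X ^ 2) ^ (i + 1) *
          (totalGF (S \ S₂) r (i + k + 1) * totalGF S₂ v (i + 1))) =
      ∑ T₁ ∈ treesOn (S \ S₂), ∑ T₂ ∈ treesOn S₂, ∑ i ∈ Finset.range N,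
        ((i + k).choose k : PowerSeries ℚ) * ((PowerSeries.X ^ 2) ^ (i + 1) *
          (coverGF T₁ r (i + k + 1) * coverGF T₂ v (i + 1))) := by
    intro S₂ v
    have h : ∀ i, totalGF (S \ S₂) r (i + k + 1) * totalGF S₂ v (i + 1) =
      ∑ T₁ ∈ treesOn (S \ S₂), ∑ T₂ ∈ treesOn S₂,
        coverGF T₁ r (i + k + 1) * coverGF T₂ v (i + 1) := fun i => Finset.sum_mul_sum _ _ _ _
    simp only [h, Finset.mul_sum]
    rw [Finset.sum_comm]
    refine Finset.sum_congr rfl fun T₁ _ => ?_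
    rw [Finset.sum_comm]
  rw [h1, sum_treesOn_neighbors hr, add_sub_add_left_eq_sub, ← Finset.sum_sub_distrib]
  refine Finset.dvd_sum fun S₂ hS₂ => ?_
  rw [← Finset.sum_sub_distrib]
  refine Finset.dvd_sum fun v hv => ?_
  rw [h2, ← Finset.sum_sub_distrib]
  refine Finset.dvd_sum fun T₁ hT₁ => ?_
  rw [← Finset.sum_sub_distrib]
  refine Finset.dvd_sum fun T₂ hT₂ => ?_
  rw [mem_treesOn] at hT₁ hT₂
  rw [Finset.mem_powerset] at hS₂
  exact coverStepGF_insert_union (P := fun x => x ∈ S \ S₂) hT₁.mem_of_mem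
    (fun e he y hy h => (Finset.mem_sdiff.1 h).2 (hT₂.mem_of_mem e he y hy))
    (Finset.mem_sdiff.2 ⟨hr, fun h => (Finset.mem_erase.1 (hS₂ h)).1 rfl⟩)
    (fun h => (Finset.mem_sdiff.1 h).2 hv) k N

/-- Both sides obey the same recursion: it lowers `j`, or splits the tree into two with fewer edges
but possibly longer tuples. Hence strong induction on `e` for all `j`, with induction on `j` inside.
Substituting `z²` turns half-length into length. -/
lemma totalGF_eq (e : ℕ) (S : Finset V) (r : V) (hr : r ∈ S) (hS : S.card = e + 1) (j : ℕ) :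
    totalGF S r j =
      (e.factorial : PowerSeries ℚ) * PowerSeries.expand 2 two_ne_zero (edgeGF j e) := by
  induction e using Nat.strong_induction_on generalizing S r j with
  | _ e ih =>
  induction j with
  | zero =>
    rw [totalGF_zero hr]
    cases e with
    | zero =>
      obtain ⟨a, rfl⟩ := Finset.card_eq_one.1 hS
      rw [Finset.mem_singleton] at hr
      subst hr
      simp [edgeGF_zero_right]
    | succ m =>
      rw [if_neg, edgeGF_zero_succ, map_zero, mul_zero]
      rintro rfl
      simp at hS
  | succ k ihk =>
    cases e with
    | zero =>
      rw [edgeGF_zero_right, ← edgeGF_zero_right k, ← ihk]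
      refine eq_of_forall_X_pow_dvd_sub fun N => ?_
      have h := totalGF_succ hr k N
      obtain ⟨a, rfl⟩ := Finset.card_eq_one.1 hS
      rw [Finset.mem_singleton] at hr
      subst hr
      simpa using h
    | succ m =>
      refine eq_of_forall_X_pow_dvd_sub fun N => ?_
      have h1 := totalGF_succ hr k N
      have h2 := map_dvd (PowerSeries.expand (R := ℚ) 2 two_ne_zero) (edgeGF_succ_succ k m N)
      simp only [map_sub, map_add, map_sum, map_mul, map_pow, map_natCast,
        PowerSeries.expand_X] at h2
      have h3 : PowerSeries.X ^ N ∣ (PowerSeries.X ^ 2 : PowerSeries ℚ) ^ N := by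
        rw [← pow_mul]; exact pow_dvd_pow _ (by omega)
      have h4 : ∑ S₂ ∈ (S.erase r).powerset, ∑ v ∈ S₂, ∑ i ∈ Finset.range N,
          ((i + k).choose k : PowerSeries ℚ) * ((PowerSeries.X ^ 2) ^ (i + 1) *
            (totalGF (S \ S₂) r (i + k + 1) * totalGF S₂ v (i + 1))) =
          ((m + 1).factorial : PowerSeries ℚ) * ∑ p ∈ antidiagonal m, ∑ i ∈ Finset.range N,
            ((i + k).choose k : PowerSeries ℚ) * ((PowerSeries.X ^ 2) ^ (i + 1) *
              (PowerSeries.expand 2 two_ne_zero (edgeGF (i + k + 1) p.1) *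
                PowerSeries.expand 2 two_ne_zero (edgeGF (i + 1) p.2))) := by
        have hcard : (S.erase r).card = m + 1 := by
          rw [Finset.card_erase_of_mem hr, hS]; rfl
        refine sum_powerset_factorial_mul hcard (fun a b => ∑ i ∈ Finset.range N,
            ((i + k).choose k : PowerSeries ℚ) * ((PowerSeries.X ^ 2) ^ (i + 1) *
              (PowerSeries.expand 2 two_ne_zero (edgeGF (i + k + 1) a) *
                PowerSeries.expand 2 two_ne_zero (edgeGF (i + 1) b)))) _ ?_ ?_
        · intro B _ hB
          rw [Finset.card_eq_zero.1 hB, Finset.sum_empty]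
        · intro B hB b hb
          have hbm : b ≤ m := by
            have := Finset.card_le_card hB
            omega
          have hB' : B ⊆ S := hB.trans (Finset.erase_subset _ _)
          have hr' : r ∈ S \ B :=
            Finset.mem_sdiff.2 ⟨hr, fun h => (Finset.mem_erase.1 (hB h)).1 rfl⟩
          have hc : (S \ B).card = (m - b) + 1 := by
            rw [Finset.card_sdiff_of_subset hB', hS, hb]
            omega
          rw [Finset.sum_congr rfl fun v hv => Finset.sum_congr rfl fun i _ => by
            rw [ih (m - b) (by omega) (S \ B) r hr' hc, ih b (by omega) B v hv hb]]
          rw [Finset.sum_const, hb, nsmul_eq_mul, Finset.mul_sum, Finset.mul_sum]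
          refine Finset.sum_congr rfl fun i _ => ?_
          push_cast
          ring
      rw [h4, ihk] at h1
      -- Once scaled by `(m + 1)!`, the edge recursion has the same right-hand side as the walk
      -- recursion; subtracting leaves the desired difference.
      have h5 := Dvd.dvd.mul_left (h3.trans h2) ((m + 1).factorial : PowerSeries ℚ)
      have h6 := dvd_sub h1 h5
      have h7 : ∑ p ∈ antidiagonal m, ∑ i ∈ Finset.range N,
            ((i + k).choose k : PowerSeries ℚ) * ((PowerSeries.X ^ 2) ^ (i + 1) *
              (PowerSeries.expand 2 two_ne_zero (edgeGF (i + k + 1) p.1) *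
                PowerSeries.expand 2 two_ne_zero (edgeGF (i + 1) p.2))) =
          ∑ i ∈ Finset.range N, ((i + k).choose k : PowerSeries ℚ) * ((PowerSeries.X ^ 2) ^ (i + 1) *
            ∑ p ∈ antidiagonal m, PowerSeries.expand 2 two_ne_zero (edgeGF (i + k + 1) p.1) *
                PowerSeries.expand 2 two_ne_zero (edgeGF (i + 1) p.2)) := by
        rw [Finset.sum_comm]
        simp only [Finset.mul_sum]
      rw [h7] at h6
      convert h6 using 1
      ring

end Total

/-! ### Identification with actual walks. -/

section Walks

variable {V : Type*} [DecidableEq V]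

/-- Möbius inversion on the Boolean lattice: the sum runs over the sets between `E` and `T` and
cancels unless they coincide. -/
lemma sum_powerset_sign_subset (T E : Finset V) :
    ∑ H ∈ T.powerset, (-1 : ℚ) ^ (T.card + H.card) * (if E ⊆ H then 1 else 0) =
      if E = T then 1 else 0 := by
  by_cases hE : E ⊆ T
  · have h1 : ∀ a ∈ E.powerset, a ≠ E → ∑ b ∈ (T \ E).powerset,
        (-1 : ℚ) ^ (T.card + (a ∪ b).card) * (if E ⊆ a ∪ b then 1 else 0) = 0 := by
      intro a ha hne
      refine Finset.sum_eq_zero fun b hb => ?_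
      rw [Finset.mem_powerset] at ha hb
      rw [if_neg, mul_zero]
      refine fun h => hne (Finset.Subset.antisymm ha fun x hx => ?_)
      refine (Finset.mem_union.1 (h hx)).resolve_right fun hxb => ?_
      exact (Finset.mem_sdiff.1 (hb hxb)).2 hx
    have h2 : ∀ b ∈ (T \ E).powerset,
        (-1 : ℚ) ^ (T.card + (E ∪ b).card) * (if E ⊆ E ∪ b then 1 else 0) =
          (-1) ^ (T.card + E.card) * (-1) ^ b.card := by
      intro b hb
      rw [Finset.mem_powerset] at hb
      rw [if_pos Finset.subset_union_left, mul_one, Finset.card_union_of_disjoint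
        (Finset.disjoint_of_subset_right hb Finset.disjoint_sdiff), ← add_assoc, pow_add]
    have h3 : (∑ b ∈ (T \ E).powerset, (-1 : ℚ) ^ b.card) =
        ((∑ b ∈ (T \ E).powerset, (-1) ^ b.card : ℤ) : ℚ) := by push_cast; rfl
    conv_lhs => rw [← Finset.union_sdiff_of_subset hE]
    rw [sum_powerset_union Finset.disjoint_sdiff, Finset.union_sdiff_of_subset hE,
      Finset.sum_eq_single E h1 (by simp), Finset.sum_congr rfl h2, ← Finset.mul_sum, h3,
      Finset.sum_powerset_neg_one_pow_card]
    by_cases hT : E = T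
    · subst hT
      simp [← two_mul]
    · rw [if_neg hT, if_neg, Int.cast_zero, mul_zero]
      rw [Finset.sdiff_eq_empty_iff_subset]
      exact fun h => hT (Finset.Subset.antisymm hE h)
  · rw [if_neg (by rintro rfl; exact hE Finset.Subset.rfl)]
    refine Finset.sum_eq_zero fun H hH => ?_
    rw [if_neg fun h => hE (h.trans (Finset.mem_powerset.1 hH)), mul_zero]

lemma IsTreeOn.not_isDiag {S : Finset V} {T : Finset (Sym2 V)} (h : IsTreeOn S T) :
    ∀ e ∈ T, ¬ e.IsDiag := by
  intro e he hd
  induction e with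
  | _ a b =>
    obtain rfl := Sym2.mk_isDiag_iff.1 hd
    exact h.bridge a a he Relation.ReflTransGen.refl

variable [Fintype V]

lemma edgeAdj_pow_eq_sum_walks {H : Finset (Sym2 V)} (hH : ∀ e ∈ H, ¬ e.IsDiag) (n : ℕ)
    (u v : V) :
    (edgeAdj H ^ n) u v = ∑ p ∈ (⊤ : SimpleGraph V).finsetWalkLength n u v,
      if p.edges.toFinset ⊆ H then 1 else 0 := by
  induction n generalizing u with
  | zero =>
    rw [pow_zero, Matrix.one_apply]
    split_ifs with h
    · subst h
      simp [SimpleGraph.finsetWalkLength, -Finset.sum_boole]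
    · simp [SimpleGraph.finsetWalkLength, h]
  | succ n ih =>
    rw [SimpleGraph.finsetWalkLength, Finset.sum_biUnion]
    · simp only [Finset.sum_map]
      rw [pow_succ', Matrix.mul_apply]
      have h : ∀ w : V, edgeAdj H u w * (edgeAdj H ^ n) w v ≠ 0 →
          (⊤ : SimpleGraph V).Adj u w := by
        intro w hw
        rw [SimpleGraph.top_adj]
        rintro rfl
        refine hw ?_
        rw [edgeAdj, Matrix.of_apply, if_neg fun h => hH _ h (Sym2.mk_isDiag_iff.2 rfl), zero_mul]
      rw [← Finset.sum_filter_of_ne fun w _ => h w,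
        Finset.sum_subtype (p := fun w => w ∈ (⊤ : SimpleGraph V).neighborSet u) _
          (fun w => by rw [Finset.mem_filter, SimpleGraph.mem_neighborSet]; simp)]
      refine Finset.sum_congr rfl fun w _ => ?_
      rw [ih, edgeAdj, Matrix.of_apply, Finset.mul_sum]
      refine Finset.sum_congr rfl fun p _ => ?_
      change _ = if (s(u, (w : V)) :: p.edges).toFinset ⊆ H then (1 : ℚ) else 0
      simp only [List.toFinset_cons, Finset.insert_subset_iff]
      by_cases h1 : s(u, (w : V)) ∈ H <;> simp [h1]
    · rintro ⟨x, hx⟩ - ⟨y, hy⟩ - hxy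
      rw [Function.onFun, Finset.disjoint_left]
      intro p hp hq
      obtain ⟨p₁, _, rfl⟩ := Finset.mem_map.1 hp
      obtain ⟨p₂, _, h⟩ := Finset.mem_map.1 hq
      have h' : SimpleGraph.Walk.cons hy p₂ = SimpleGraph.Walk.cons hx p₁ := h
      injection h' with _ h₁
      exact hxy (Subtype.ext h₁.symm)

lemma coeff_coverGF_one {T : Finset (Sym2 V)} (hT : ∀ e ∈ T, ¬ e.IsDiag) (n : ℕ) (r : V) :
    PowerSeries.coeff n (coverGF T r 1) =
      (((⊤ : SimpleGraph V).finsetWalkLength n r r).filter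
        fun p => p.edges.toFinset = T).card := by
  have h : ∀ H ∈ T.powerset, PowerSeries.coeff n ((-1 : PowerSeries ℚ) ^ (T.card + H.card) *
      walkGF H r r ^ 1) = ∑ p ∈ (⊤ : SimpleGraph V).finsetWalkLength n r r,
        (-1 : ℚ) ^ (T.card + H.card) * if p.edges.toFinset ⊆ H then 1 else 0 := by
    intro H hH
    rw [Finset.mem_powerset] at hH
    rw [pow_one, ← Finset.mul_sum, ← edgeAdj_pow_eq_sum_walks fun e he => hT e (hH he),
      show (-1 : PowerSeries ℚ) ^ (T.card + H.card) =
        PowerSeries.C ((-1 : ℚ) ^ (T.card + H.card)) by simp,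
      PowerSeries.coeff_C_mul, walkGF, coeff_mk]
  rw [coverGF, map_sum, Finset.sum_congr rfl h, Finset.sum_comm]
  simp only [sum_powerset_sign_subset]
  rw [Finset.sum_boole]

lemma isTree_fromEdgeSet_iff {T : Finset (Sym2 V)} (hT : ∀ e ∈ T, ¬ e.IsDiag) [Nonempty V] :
    (SimpleGraph.fromEdgeSet (T : Set (Sym2 V))).IsTree ↔ IsTreeOn Finset.univ T := by
  set G := SimpleGraph.fromEdgeSet (T : Set (Sym2 V))
  have hadj : ∀ a b, G.Adj a b ↔ s(a, b) ∈ T := by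
    intro a b
    rw [SimpleGraph.fromEdgeSet_adj, Finset.mem_coe, and_iff_left_iff_imp]
    rintro h rfl
    exact hT _ h (Sym2.mk_isDiag_iff.2 rfl)
  have hreach : ∀ a b, G.Reachable a b ↔ EdgeReach T a b := by
    intro a b
    rw [SimpleGraph.reachable_iff_reflTransGen, EdgeReach]
    simp only [← hadj]
  have hbridge : ∀ a b, G.IsBridge s(a, b) ↔ ¬ EdgeReach (T.erase s(a, b)) a b := by
    intro a b
    rw [SimpleGraph.isBridge_iff, SimpleGraph.reachable_iff_reflTransGen, EdgeReach]
    have : (G.deleteEdges {s(a, b)}).Adj = fun x y => s(x, y) ∈ T.erase s(a, b) := by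
      ext x y
      rw [SimpleGraph.deleteEdges_adj, hadj, Finset.mem_erase, Set.mem_singleton_iff, and_comm]
    rw [this]
  rw [SimpleGraph.isTree_iff, SimpleGraph.connected_iff,
    SimpleGraph.isAcyclic_iff_forall_adj_isBridge]
  constructor
  · rintro ⟨⟨hc, -⟩, hb⟩
    exact ⟨fun _ _ _ _ => Finset.mem_univ _, fun u _ w _ => (hreach u w).1 (hc u w),
      fun a b hab => (hbridge a b).1 (hb ((hadj a b).2 hab))⟩
  · intro h
    exact ⟨⟨fun u w => (hreach u w).2 (h.reach u (Finset.mem_univ _) w (Finset.mem_univ _)),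
      inferInstance⟩, fun a b hab => (hbridge a b).2 (h.bridge a b ((hadj a b).1 hab))⟩

lemma isTree_fromEdgeSet_edges_iff {r : V} (p : (⊤ : SimpleGraph V).Walk r r) :
    (SimpleGraph.fromEdgeSet {e | e ∈ p.edges}).IsTree ↔
      IsTreeOn Finset.univ p.edges.toFinset := by
  have : Nonempty V := ⟨r⟩
  rw [← isTree_fromEdgeSet_iff, List.coe_toFinset]
  intro e he
  exact SimpleGraph.not_isDiag_of_mem_edgeSet _ (p.edges_subset_edgeSet (List.mem_toFinset.1 he))

/-- Shows that the tree condition already implies the field `visits` of `TreeWalk`. -/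
lemma mem_support_of_isTreeOn {r : V} {p : (⊤ : SimpleGraph V).Walk r r}
    (h : IsTreeOn Finset.univ p.edges.toFinset) (x : V) : x ∈ p.support :=
  EdgeReach.invariant (P := fun y => y ∈ p.support)
    (fun _ _ _ hab => p.snd_mem_support_of_mem_edges (List.mem_toFinset.1 hab))
    (h.reach r (Finset.mem_univ _) x (Finset.mem_univ _)) p.start_mem_support

end Walks

open Classical in
/-- Tree walks as pairs of a root and a closed walk. -/
noncomputable def treeWalkEquiv (m L : ℕ) : TreeWalk m L ≃
    Σ r : Fin m, {p // p ∈ ((⊤ : SimpleGraph (Fin m)).finsetWalkLength L r r).filter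
      fun p => IsTreeOn Finset.univ p.edges.toFinset} where
  toFun W := ⟨W.root, W.walk, Finset.mem_filter.2
    ⟨SimpleGraph.mem_finsetWalkLength_iff.2 W.length_eq,
      (isTree_fromEdgeSet_edges_iff W.walk).1 W.isTree⟩⟩
  invFun q :=
    { root := q.1
      walk := q.2.1
      length_eq := SimpleGraph.mem_finsetWalkLength_iff.1 (Finset.mem_filter.1 q.2.2).1
      visits := mem_support_of_isTreeOn (Finset.mem_filter.1 q.2.2).2
      isTree := (isTree_fromEdgeSet_edges_iff q.2.1).2 (Finset.mem_filter.1 q.2.2).2 }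
  left_inv _ := rfl
  right_inv _ := rfl

lemma numTreeWalks_eq_sum (m L : ℕ) :
    (numTreeWalks m L : ℚ) = ∑ r : Fin m, PowerSeries.coeff L (totalGF Finset.univ r 1) := by
  classical
  rw [numTreeWalks, Nat.card_congr (treeWalkEquiv m L), Nat.card_sigma, Nat.cast_sum]
  refine Finset.sum_congr rfl fun r _ => ?_
  rw [Nat.card_eq_fintype_card, Fintype.card_coe, totalGF, map_sum,
    Finset.card_eq_sum_card_fiberwise
      (s := ((⊤ : SimpleGraph (Fin m)).finsetWalkLength L r r).filter
        fun p => IsTreeOn Finset.univ p.edges.toFinset) (f := fun p => p.edges.toFinset)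
      (t := treesOn Finset.univ)
      (fun p hp => mem_treesOn.2 (Finset.mem_filter.1 hp).2), Nat.cast_sum]
  refine Finset.sum_congr rfl fun T hT => ?_
  rw [mem_treesOn] at hT
  rw [coeff_coverGF_one hT.not_isDiag, Finset.filter_filter]
  congr 2
  refine Finset.filter_congr fun p _ => ⟨fun h => h.2, fun h => ⟨?_, h⟩⟩
  rw [h]
  exact hT

/-- Each of the `e + 1` roots contributes `e!` times the same coefficient, and `(e + 1) * e! = (e +
1)!`. -/
lemma numTreeWalks_div_factorial (e l : ℕ) :
    (numTreeWalks (e + 1) (2 * l) : ℚ) / (e + 1).factorial =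
      PowerSeries.coeff l (edgeGF 1 e) := by
  have h : ∀ r : Fin (e + 1), PowerSeries.coeff (2 * l) (totalGF Finset.univ r 1) =
      e.factorial * PowerSeries.coeff l (edgeGF 1 e) := by
    intro r
    rw [totalGF_eq e Finset.univ r (Finset.mem_univ _) (by simp),
      ← map_natCast (PowerSeries.C (R := ℚ)), PowerSeries.coeff_C_mul, PowerSeries.coeff_expand_mul]
  rw [numTreeWalks_eq_sum, Finset.sum_congr rfl fun r _ => h r, Finset.sum_const,
    Finset.card_univ, Fintype.card_fin, nsmul_eq_mul, div_eq_iff (by positivity),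
    Nat.factorial_succ]
  push_cast
  ring

lemma excessGF_eq_tupleGF (n : ℕ) : excessGF n = tupleGF n 1 := by
  ext l
  rw [excessGF, coeff_mk]
  split_ifs with h
  · rw [numTreeWalks_div_factorial, edgeGF, coeff_mk, if_pos (by omega),
      show l - (l - n) = n by omega]
  · rw [coeff_tupleGF_of_lt (by omega)]

end TreeWalkKernel

theorem theorem1 :
    excessGF 0 = catalanGF ∧
    ∀ ξ : ℕ, 1 ≤ ξ →
      ∃ K : ℕ → ℚ[X],
        (∀ s : ℕ, s ≤ 2 * ξ - 2 →
          (∀ i : ℕ, 0 ≤ (K s).coeff i) ∧ (K s).degree = ((2 * ξ + s : ℕ) : WithBot ℕ)) ∧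
        excessGF ξ =
          catalanGF *
            ∑ s ∈ Finset.range (2 * ξ - 2 + 1),
              Polynomial.aeval (PowerSeries.X * catalanGF ^ 2) (K s) *
                ((1 - PowerSeries.X * catalanGF ^ 2) ^ (s + 1))⁻¹ ∧
        K (2 * ξ - 2) =
          Polynomial.C (catalan (ξ - 1) : ℚ) * Polynomial.X ^ (4 * ξ - 2) ∧
        (2 ≤ ξ →
          K (2 * ξ - 3) =
            Polynomial.C ((3 * (ξ : ℚ) - 1) * (catalan (ξ - 1) : ℚ)) *
              Polynomial.X ^ (4 * ξ - 3)) := by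
  refine ⟨?_, fun ξ hξ => ⟨TreeWalkKernel.kernelNumerator ξ, fun s hs =>
    ⟨TreeWalkKernel.kernelNumerator_coeff_nonneg ξ s,
      TreeWalkKernel.degree_kernelNumerator hξ hs⟩, ?_,
    TreeWalkKernel.kernelNumerator_top hξ, TreeWalkKernel.kernelNumerator_second⟩⟩
  · rw [TreeWalkKernel.excessGF_eq_tupleGF, TreeWalkKernel.tupleGF, TreeWalkKernel.branch_zero,
      map_one, mul_one, pow_one]
  · rw [TreeWalkKernel.excessGF_eq_tupleGF]
    exact TreeWalkKernel.tupleGF_one_eq_sum (by omega)
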